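/- Let $(\Omega,\mathcal F,\mathbb P)$ be a probability space, and let $L_0$ be the space of real random variables modulo a.s. equality, with the topology of convergence in probability and the a.s. pointwise order. Let $\Phi:\mathbb R\to\mathbb R$ be a (finite coercive) Young function, i.e. an even convex function with $\Phi(0)=0$ and $\lim_{x\to+\infty}\Phi(x)/x=+\infty$, and assume $\Phi\in\Delta_2$, i.e. $\limsup_{x\to\infty}\Phi(2x)/\Phi(x)<\infty$. Let $\Phi^*(y)=\sup_{x\in\mathbb R}(xy-\Phi(x))$ be the conjugate, which is again a Young function, and for a Young function $\Psi$ let $L_\Psi=\{\xi\in L_0:\ \exists\lambda>0,\ \mathbb E[\Psi(\lambda\xi)]<\infty\}$ be its Orlicz space. Let $\sigma(L_{\Phi^*},L_\Phi)$ be the weak topology on $L_{\Phi^*}$ for the pairing $(\eta,\xi)\mapsto\mathbb E[\eta\xi]$, i.e. the coarsest topology that makes $\xi\mapsto\mathbb E[\eta\xi]$ continuous for every $\eta\in L_\Phi$. Then a convex subset $C\subset L_{\Phi^*}$ is $\sigma(L_{\Phi^*},L_\Phi)$-closed if and only if $C$ is order closed in the following sense: for every $\zeta\in L_{\Phi^*}$,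 the set $C\cap[-\zeta,\zeta]$ is closed in $L_0$, where $[-\zeta,\zeta]=\{\xi\in L_0:-\zeta\le\xi\le\zeta\}$. -/

import Mathlib

open MeasureTheory Filter Topology
open scoped ENNReal

noncomputable section

/-- A (finite coercive) Young function: an even convex function `Φ : ℝ → ℝ` with `Φ 0 = 0` and
`Φ x / x → ∞` as `x → +∞`. -/
structure IsYoung (Φ : ℝ → ℝ) : Prop where
  even : ∀ x, Φ (-x) = Φ x
  convex : ConvexOn ℝ Set.univ Φ
  zero : Φ 0 = 0
  coercive : Tendsto (fun x => Φ x / x) atTop atTop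

/-- The `Δ₂`-condition `limsup_{x → ∞} Φ (2 x) / Φ x < ∞`; the upper limit is taken in the
extended reals, so that an unbounded quotient has upper limit `⊤`. -/
def IsDeltaTwo (Φ : ℝ → ℝ) : Prop :=
  limsup (fun x : ℝ => ((Φ (2 * x) / Φ x : ℝ) : EReal)) atTop < ⊤

/-- The conjugate `Φ* (y) = sup_x (x y - Φ x)`. For a Young function the supremum is over a set
that is bounded above, because `Φ` is coercive. -/
def youngConj (Φ : ℝ → ℝ) (y : ℝ) : ℝ := ⨆ x : ℝ, x * y - Φ x

variable {Ω : Type*} [MeasurableSpace Ω]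

/-- The Orlicz space `L_Φ`: the classes `ξ ∈ L₀` for which there is `c > 0` with
`E[Φ (c ξ)] < ∞`. The integrand is nonnegative when `Φ` is a Young function, so the expectation
is a lower integral. -/
def orliczSpace (P : Measure Ω) (Φ : ℝ → ℝ) : Set (Ω →ₘ[P] ℝ) :=
  {ξ | ∃ c : ℝ, 0 < c ∧ ∫⁻ ω, ENNReal.ofReal (Φ (c * ξ ω)) ∂P < ∞}

theorem integrable_min_abs_sub_one (P : Measure Ω) [IsProbabilityMeasure P] (f g : Ω →ₘ[P] ℝ) :
    Integrable (fun ω => min |f ω - g ω| 1) P := by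
  refine Integrable.of_bound (C := 1) ?_ ?_
  · exact ((f.aestronglyMeasurable.sub g.aestronglyMeasurable).norm.inf
      aestronglyMeasurable_const)
  · refine Eventually.of_forall fun ω => ?_
    rw [Real.norm_of_nonneg (le_min (abs_nonneg _) zero_le_one)]
    exact min_le_right _ _

/-- The metric `d (f, g) = E[|f - g| ∧ 1]` on `L₀`, which metrises convergence in probability. -/
@[reducible]
def lzeroMetric (P : Measure Ω) [IsProbabilityMeasure P] : MetricSpace (Ω →ₘ[P] ℝ) where
  dist f g := ∫ ω, min |f ω - g ω| 1 ∂P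
  dist_self f := by simp
  dist_comm f g := by simp only [abs_sub_comm]
  dist_triangle f g h := by
    rw [← integral_add (integrable_min_abs_sub_one P f g) (integrable_min_abs_sub_one P g h)]
    refine integral_mono (integrable_min_abs_sub_one P f h)
      ((integrable_min_abs_sub_one P f g).add (integrable_min_abs_sub_one P g h)) fun ω => ?_
    have h1 := abs_sub_le (f ω) (g ω) (h ω)
    have h2 := abs_nonneg (f ω - g ω)
    have h3 := abs_nonneg (g ω - h ω)
    rcases le_total |f ω - g ω| 1 with h4 | h4 <;> rcases le_total |g ω - h ω| 1 with h5 | h5 <;>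
      simp only [min_eq_left, min_eq_right, h4, h5] <;>
      first
        | exact (min_le_left _ _).trans h1
        | exact (min_le_right _ _).trans (by linarith)
  eq_of_dist_eq_zero {f g} hfg := by
    rw [integral_eq_zero_iff_of_nonneg (fun ω => le_min (abs_nonneg _) zero_le_one)
      (integrable_min_abs_sub_one P f g)] at hfg
    refine AEEqFun.ext (hfg.mono fun ω hω => ?_)
    simp only [Pi.zero_apply] at hω
    rcases min_choice |f ω - g ω| 1 with h | h
    · rw [h] at hω
      exact sub_eq_zero.1 (abs_eq_zero.1 hω)
    · rw [h] at hω
      exact absurd hω one_ne_zero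

/-- The topology of convergence in probability on `L₀`. -/
@[reducible]
def lzeroTopology (P : Measure Ω) [IsProbabilityMeasure P] : TopologicalSpace (Ω →ₘ[P] ℝ) :=
  (lzeroMetric P).toUniformSpace.toTopologicalSpace

/-- The weak topology `σ(L_Ψ, L_Φ)` for the pairing `⟨η, ξ⟩ = E[η ξ]`: the coarsest topology on
`L_Ψ` for which `ξ ↦ E[η ξ]` is continuous for every `η ∈ L_Φ`. -/
@[reducible]
def orliczWeakTopology (P : Measure Ω) (Ψ Φ : ℝ → ℝ) : TopologicalSpace (orliczSpace P Ψ) :=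
  ⨅ η : orliczSpace P Φ, TopologicalSpace.induced
    (fun ξ : orliczSpace P Ψ => ∫ ω, η.1 ω * ξ.1 ω ∂P) inferInstance

/-- A set `C` is order closed in `L_Ψ`: for every `ζ ∈ L_Ψ` its intersection with the order
interval `[-ζ, ζ]` (for the a.s. pointwise order) is closed in `L₀`. -/
def IsOrderClosed (P : Measure Ω) [IsProbabilityMeasure P] (Ψ : ℝ → ℝ)
    (C : Set (Ω →ₘ[P] ℝ)) : Prop :=
  ∀ ζ ∈ orliczSpace P Ψ, IsClosed[lzeroTopology P] (C ∩ Set.Icc (-ζ) ζ)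

end

/-!
The easy half is dominated convergence: on an order interval `[-ζ, ζ]` of `L_{Φ*}`, a.e. convergence
implies `σ(L_{Φ*}, L_Φ)`-convergence, because `η ζ` is integrable for every `η ∈ L_Φ`
(`integrable_mul_of_mem`). Closedness in `L₀` is handled throughout as closedness under a.e. limits
of sequences (`isClosed_lzero_iff`).

The other half rests on two facts about a convex set `C`.

* If `C` is order closed, it contains the a.e. limits of its modular bounded sequences. This is
  where `Φ ∈ Δ₂` enters (`exists_dominated_combinations`). Let `d k` be the differences to the limit. The
  average of `N` of the `|d k|` is at most `1 / N` times the largest plus an average of pairwise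
  minima, and the modulars of the minima can be made small by dominated convergence, choosing the
  terms one after the other. By the `Δ₂`-condition `N Ψ(x / N)` is small compared with `Ψ(x)` for
  `Ψ = Φ*` and a large `N`, so the modulars of the averages can be made summable, at a fixed scale.
  Then the supremum of the averages lies in `L_Ψ`, and order closedness applies to them.

* If `D = C - ξ₀` does not contain `0` and all its intersections with modular balls are closed under
  a.e. limits, then some `η ∈ L_Φ` is bounded below on `D` by a positive constant
  (`exists_separating_element`). This is the Krein–Šmulian argument, done by hand. Disjoint convex
  sets that are closed under a.e. limits and bounded in `L¹` have positive `L¹`-distance, because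
  minimising the strictly convex `E[√(1 + ξ²)]` replaces weak compactness
  (`exists_ae_tendsto_of_antitone`), so bounded random variables separate them
  (`exists_strict_separation`). Doing this along balls that grow like `4ᵏ` gives functionals `η k`
  of dual norm of order `4⁻ᵏ`; the map `ξ ↦ (2ᵏ E[η k ξ])` sends `D` into `ℓ²` outside the unit
  ball, and a separating vector of `ℓ²` turns the `η k` into a single element of `L_Φ`.
-/

section

variable {Ω : Type*} [MeasurableSpace Ω] {P : Measure Ω}

/-! ### Young functions -/

namespace IsYoung

variable {Φ : ℝ → ℝ}

theorem abs (h : IsYoung Φ) (x : ℝ) : Φ |x| = Φ x := by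
  rcases abs_choice x with hx | hx <;> rw [hx]
  exact h.even x

theorem le_midpoint (h : IsYoung Φ) (x y : ℝ) :
    Φ ((x + y) / 2) ≤ (Φ x + Φ y) / 2 := by
  have := h.convex.2 (Set.mem_univ x) (Set.mem_univ y) (by norm_num : (0 : ℝ) ≤ 1 / 2)
    (by norm_num : (0 : ℝ) ≤ 1 / 2) (by norm_num)
  simp only [smul_eq_mul] at this
  calc Φ ((x + y) / 2) = Φ (1 / 2 * x + 1 / 2 * y) := by ring_nf
    _ ≤ _ := this
    _ = _ := by ring

theorem nonneg (h : IsYoung Φ) (x : ℝ) : 0 ≤ Φ x := by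
  have := h.le_midpoint x (-x)
  rw [add_neg_cancel, zero_div, h.zero, h.even] at this
  linarith

theorem mul_le (h : IsYoung Φ) {t : ℝ} (ht : 0 ≤ t) (ht1 : t ≤ 1) (x : ℝ) :
    Φ (t * x) ≤ t * Φ x := by
  have := h.convex.2 (Set.mem_univ x) (Set.mem_univ 0) ht (sub_nonneg.2 ht1) (by ring)
  simpa [h.zero] using this

theorem mono (h : IsYoung Φ) {x y : ℝ} (hxy : |x| ≤ |y|) : Φ x ≤ Φ y := by
  rcases eq_or_ne y 0 with rfl | hy
  · rw [abs_zero] at hxy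
    rw [abs_nonpos_iff.1 hxy]
  · have hy' : 0 < |y| := abs_pos.2 hy
    have h1 : |x| / |y| ≤ 1 := (div_le_one hy').2 hxy
    have := h.mul_le (div_nonneg (abs_nonneg x) hy'.le) h1 |y|
    rw [div_mul_cancel₀ _ hy'.ne', h.abs, h.abs] at this
    exact this.trans (mul_le_of_le_one_left (h.nonneg y) h1)

theorem continuous (h : IsYoung Φ) : Continuous Φ := by
  rw [← continuousOn_univ]
  exact h.convex.continuousOn isOpen_univ

theorem measurable (h : IsYoung Φ) : Measurable Φ := h.continuous.measurable

theorem exists_mul_le (h : IsYoung Φ) (K : ℝ) : ∃ M : ℝ, 1 ≤ M ∧ ∀ x, M ≤ |x| → K * |x| ≤ Φ x := by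
  obtain ⟨M, hM⟩ := eventually_atTop.1 (h.coercive.eventually_ge_atTop K)
  refine ⟨max M 1, le_max_right _ _, fun x hx => ?_⟩
  have h1 := hM |x| ((le_max_left _ _).trans hx)
  have h2 : 0 < |x| := lt_of_lt_of_le one_pos ((le_max_right _ _).trans hx)
  rw [le_div_iff₀ h2, h.abs] at h1
  exact h1

theorem bddAbove (h : IsYoung Φ) (y : ℝ) : BddAbove (Set.range fun x : ℝ => x * y - Φ x) := by
  obtain ⟨M, hM, hK⟩ := h.exists_mul_le |y|
  refine ⟨M * |y|, ?_⟩
  rintro _ ⟨x, rfl⟩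
  have h1 : x * y ≤ |x| * |y| := by rw [← abs_mul]; exact le_abs_self _
  have h2 := h.nonneg x
  simp only
  rcases le_total M |x| with h3 | h3
  · have := hK x h3
    have : 0 ≤ M * |y| := by positivity
    nlinarith
  · have := mul_le_mul_of_nonneg_right h3 (abs_nonneg y)
    linarith

/-- The Fenchel–Young inequality. -/
theorem mul_le_add (h : IsYoung Φ) (x y : ℝ) : x * y ≤ Φ x + youngConj Φ y := by
  have := le_ciSup (h.bddAbove y) x
  simp only [youngConj]
  linarith

theorem conj_le {y c : ℝ} (hc : ∀ x, x * y - Φ x ≤ c) : youngConj Φ y ≤ c := ciSup_le hc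

theorem conj (h : IsYoung Φ) : IsYoung (youngConj Φ) where
  even y := by
    have : ∀ y, youngConj Φ (-y) ≤ youngConj Φ y := fun y => conj_le fun x => by
      have := h.mul_le_add (-x) y
      rw [h.even] at this
      linarith
    exact le_antisymm (this y) (by simpa using this (-y))
  convex := by
    refine ⟨convex_univ, fun y _ z _ a b ha hb hab => conj_le fun x => ?_⟩
    have h1 := mul_le_mul_of_nonneg_left (h.mul_le_add x y) ha
    have h2 := mul_le_mul_of_nonneg_left (h.mul_le_add x z) hb
    have h3 : Φ x = a * Φ x + b * Φ x := by rw [← add_mul, hab, one_mul]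
    simp only [smul_eq_mul]
    linarith
  zero := by
    refine le_antisymm (conj_le fun x => by simpa using h.nonneg x) ?_
    have := h.mul_le_add 0 0
    rw [h.zero] at this
    linarith
  coercive := by
    refine tendsto_atTop.2 fun K => ?_
    filter_upwards [eventually_ge_atTop (max 1 (Φ (K + 1)))] with y hy
    have hy1 : 1 ≤ y := (le_max_left _ _).trans hy
    rw [le_div_iff₀ (by linarith)]
    have := h.mul_le_add (K + 1) y
    have := (le_max_right _ _).trans hy
    linarith

/-- The test element `Φ x / x` has conjugate value at most `Φ x`, which spares the use of a
subgradient of `Φ`. For `x = 0` the quotient is `0` by convention and the bound still holds. -/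
theorem conj_div_le (h : IsYoung Φ) (x : ℝ) : youngConj Φ (Φ x / x) ≤ Φ x := by
  rcases eq_or_ne x 0 with rfl | hx
  · rw [div_zero, h.conj.zero]
    exact h.nonneg 0
  refine conj_le fun z => ?_
  have hx' : 0 < |x| := abs_pos.2 hx
  have h1 : z * (Φ x / x) ≤ |z| / |x| * Φ x := by
    refine (le_abs_self _).trans (le_of_eq ?_)
    rw [abs_mul, abs_div, abs_of_nonneg (h.nonneg x)]
    ring
  rcases le_total |z| |x| with hz | hz
  · have := mul_le_of_le_one_left (h.nonneg x) ((div_le_one hx').2 hz)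
    linarith [h.nonneg z]
  · -- `Φ x / |x| ≤ Φ z / |z|` because difference quotients at `0` increase
    have hz' : 0 < |z| := hx'.trans_le hz
    have h2 := h.mul_le (div_nonneg hx'.le hz'.le) ((div_le_one hz').2 hz) |z|
    rw [div_mul_cancel₀ _ hz'.ne', h.abs, h.abs] at h2
    have h3 : |z| / |x| * Φ x ≤ |z| / |x| * (|x| / |z| * Φ z) := by gcongr
    have h4 : |z| / |x| * (|x| / |z| * Φ z) = Φ z := by field_simp
    linarith [h.nonneg x]

/-- The `Δ₂`-condition for `Φ` makes the conjugate grow faster than linearly under a fixed dilation,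
which is the `∇₂`-condition. -/
theorem exists_two_mul_conj_le (h : IsYoung Φ) (hΔ : IsDeltaTwo Φ) :
    ∃ a : ℕ, 2 ≤ a ∧ ∃ y₀ : ℝ, 0 ≤ y₀ ∧
      ∀ y, y₀ ≤ y → 2 * a * youngConj Φ y ≤ youngConj Φ (a * y) := by
  obtain ⟨L, hL, -⟩ := EReal.lt_iff_exists_real_btwn.1 hΔ
  have hL' := eventually_lt_of_limsup_lt hL
  have hpos : ∀ᶠ x in atTop, 0 < Φ x := by
    filter_upwards [h.coercive.eventually_gt_atTop 0, eventually_gt_atTop 0] with x hx hx0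
    exact (div_pos_iff_of_pos_right hx0).1 hx
  obtain ⟨x₀, hx₀⟩ := eventually_atTop.1 (hL'.and hpos)
  obtain ⟨a, ha⟩ := exists_nat_ge (max L 2)
  have ha2 : (2 : ℝ) ≤ a := (le_max_right _ _).trans ha
  obtain ⟨M, hM1, hM⟩ := h.conj.exists_mul_le (2 * |x₀|)
  refine ⟨a, by exact_mod_cast ha2, M, by linarith, fun y hy => ?_⟩
  have hy0 : 0 ≤ y := by linarith
  have ha0 : (0 : ℝ) < 2 * a := by linarith
  rw [mul_comm, ← le_div_iff₀ ha0]
  refine conj_le fun x => ?_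
  rw [le_div_iff₀ ha0]
  rcases le_total x₀ x with hx | hx
  · obtain ⟨h1, h2⟩ := hx₀ x hx
    have h3 : Φ (2 * x) / Φ x < L := by exact_mod_cast h1
    rw [div_lt_iff₀ h2] at h3
    have h4 : L * Φ x ≤ 2 * a * Φ x := by
      refine mul_le_mul_of_nonneg_right ?_ h2.le
      linarith [(le_max_left L 2).trans ha]
    have h5 := h.mul_le_add (2 * x) (a * y)
    nlinarith
  · have h1 : y ≤ a * y := by nlinarith
    have hay : |(a : ℝ) * y| = a * y := abs_of_nonneg (mul_nonneg (by positivity) hy0)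
    have h2 := hM (a * y) (by rw [hay]; linarith)
    rw [hay] at h2
    have h3 : x * y ≤ |x₀| * y := mul_le_mul_of_nonneg_right (hx.trans (le_abs_self _)) hy0
    have h4 := mul_le_mul_of_nonneg_right (a := (a : ℝ)) (by linarith [h.nonneg x] :
      x * y - Φ x ≤ |x₀| * y) (by positivity)
    linarith

/-- Under `Δ₂`, the total modular of `N` disjoint copies of `x / N` is small relative to that of
`x`, up to a term that only sees the part of `x` below a fixed level. The dilation inequality
`2 a Ψ y ≤ Ψ (a y)` of the conjugate `Ψ` is iterated `m` times, with `N = aᵐ`. -/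
theorem exists_conj_div_le (h : IsYoung Φ) (hΔ : IsDeltaTwo Φ) {ε : ℝ} (hε : 0 < ε) :
    ∃ N : ℕ, 0 < N ∧ ∃ y₁ : ℝ, 0 ≤ y₁ ∧ ∀ x, 0 ≤ x →
      N * youngConj Φ (x / N) ≤ ε * youngConj Φ x + N * youngConj Φ (min x y₁) := by
  obtain ⟨a, ha, y₀, hy₀, h2⟩ := h.exists_two_mul_conj_le hΔ
  have ha2 : (2 : ℝ) ≤ a := by exact_mod_cast ha
  obtain ⟨m, hm⟩ := exists_pow_lt_of_lt_one hε (by norm_num : (1 / 2 : ℝ) < 1)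
  have hit : ∀ m : ℕ, ∀ y, y₀ ≤ y → (2 * a : ℝ) ^ m * youngConj Φ y ≤ youngConj Φ (a ^ m * y) := by
    intro m
    induction m with
    | zero => simp
    | succ k ih =>
      intro y hy
      have h3 : y₀ ≤ a * y := by nlinarith
      calc (2 * a : ℝ) ^ (k + 1) * youngConj Φ y = (2 * a) ^ k * (2 * a * youngConj Φ y) := by ring
        _ ≤ (2 * a) ^ k * youngConj Φ (a * y) := by
          exact mul_le_mul_of_nonneg_left (h2 y hy) (by positivity)
        _ ≤ youngConj Φ (a ^ k * (a * y)) := ih _ h3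
        _ = _ := by ring_nf
  have haN : (0 : ℝ) < (a : ℝ) ^ m := by positivity
  have haN1 : (1 : ℝ) ≤ (a : ℝ) ^ m := one_le_pow₀ (by linarith)
  refine ⟨a ^ m, by positivity, y₀, hy₀, fun x hx => ?_⟩
  push_cast
  have hn := h.conj.nonneg
  rcases le_total y₀ (x / a ^ m) with hxy | hxy
  · have h3 := hit m _ hxy
    rw [mul_div_cancel₀ _ haN.ne', mul_pow] at h3
    have h4 : (a : ℝ) ^ m * youngConj Φ (x / a ^ m) ≤ (1 / 2) ^ m * youngConj Φ x := by
      rw [one_div, inv_pow, inv_mul_eq_div, le_div_iff₀ (by positivity)]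
      linarith
    have h5 := mul_le_mul_of_nonneg_right hm.le (hn x)
    have h6 := mul_nonneg haN.le (hn (min x y₀))
    linarith
  · have h3 : youngConj Φ (x / a ^ m) ≤ youngConj Φ (min x y₀) := by
      refine h.conj.mono ?_
      rw [abs_of_nonneg (by positivity), abs_of_nonneg (le_min hx hy₀)]
      exact le_min (div_le_self hx haN1) hxy
    have h4 := mul_le_mul_of_nonneg_left h3 haN.le
    have h5 := mul_nonneg hε.le (hn x)
    linarith

end IsYoung

/-! ### Modulars and almost everywhere limits -/

/-- The modular `E[Ψ(f)]` of a nonnegative `Ψ`, as an extended nonnegative number. -/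
noncomputable def modular (P : Measure Ω) (Ψ : ℝ → ℝ) (f : Ω → ℝ) : ℝ≥0∞ :=
  ∫⁻ ω, ENNReal.ofReal (Ψ (f ω)) ∂P

/-- A set of random variables is a.e. closed if it contains the limits of its a.e. convergent
sequences. This is equivalent to being closed for convergence in probability. -/
def AEClosed (P : Measure Ω) (D : Set (Ω →ₘ[P] ℝ)) : Prop :=
  ∀ (u : ℕ → Ω →ₘ[P] ℝ) (f : Ω →ₘ[P] ℝ), (∀ k, u k ∈ D) →
    (∀ᵐ ω ∂P, Tendsto (fun k => u k ω) atTop (𝓝 (f ω))) → f ∈ D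

theorem ae_summable_of_tsum_lintegral {g : ℕ → Ω → ℝ} (hg : ∀ k, AEMeasurable (g k) P)
    (hg0 : ∀ k ω, 0 ≤ g k ω) (hsum : ∑' k, ∫⁻ ω, ENNReal.ofReal (g k ω) ∂P ≠ ∞) :
    ∀ᵐ ω ∂P, Summable fun k => g k ω := by
  rw [← lintegral_tsum fun k => (hg k).ennreal_ofReal] at hsum
  have := ae_lt_top' (AEMeasurable.tsum fun k => (hg k).ennreal_ofReal) hsum
  filter_upwards [this] with ω hω
  have := ENNReal.summable_toReal hω.ne
  simpa only [ENNReal.toReal_ofReal (hg0 _ ω)] using this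

theorem tsum_ne_top_of_le_geometric {G : ℕ → ℝ≥0∞} (hG : ∀ k, G k ≤ ENNReal.ofReal ((1 / 2) ^ k)) :
    ∑' k, G k ≠ ∞ := by
  refine ne_top_of_le_ne_top ?_ (ENNReal.tsum_le_tsum hG)
  rw [← ENNReal.ofReal_tsum_of_nonneg (fun _ => by positivity) summable_geometric_two]
  exact ENNReal.ofReal_ne_top

theorem tendsto_zero_of_min_one {x : ℕ → ℝ} (hx : Tendsto (fun k => min |x k| 1) atTop (𝓝 0)) :
    Tendsto x atTop (𝓝 0) := by
  rw [tendsto_zero_iff_abs_tendsto_zero]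
  refine hx.congr' ?_
  filter_upwards [hx.eventually_lt_const one_pos] with k hk
  rcases min_lt_iff.1 hk with h | h
  · exact min_eq_left h.le
  · exact absurd h (lt_irrefl _)

theorem lzero_dist_lintegral [IsProbabilityMeasure P] (f g : Ω →ₘ[P] ℝ) :
    ∫⁻ ω, ENNReal.ofReal (min |f ω - g ω| 1) ∂P = ENNReal.ofReal ((lzeroMetric P).dist f g) :=
  (ofReal_integral_eq_lintegral_ofReal (integrable_min_abs_sub_one P f g)
    (Eventually.of_forall fun _ => le_min (abs_nonneg _) zero_le_one)).symm

theorem aemeasurable_min_abs_sub (f g : Ω →ₘ[P] ℝ) :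
    AEMeasurable (fun ω => min |f ω - g ω| 1) P := by
  have := f.aemeasurable
  have := g.aemeasurable
  fun_prop

/-- Closedness in `L₀` is closedness under a.e. limits of sequences: a.e. convergence implies
convergence in probability, and a sequence that converges in probability has an a.e. convergent
subsequence. -/
theorem isClosed_lzero_iff [IsProbabilityMeasure P] {D : Set (Ω →ₘ[P] ℝ)} :
    IsClosed[lzeroTopology P] D ↔ AEClosed P D := by
  let _ := lzeroMetric P
  constructor
  · intro hD u f hu hlim
    have h : Tendsto (fun k => ∫ ω, min |u k ω - f ω| 1 ∂P) atTop (𝓝 (∫ _, (0 : ℝ) ∂P)) := by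
      refine tendsto_integral_of_dominated_convergence (fun _ => 1)
        (fun k => (aemeasurable_min_abs_sub _ _).aestronglyMeasurable) (integrable_const _)
        (fun k => Eventually.of_forall fun ω => ?_) ?_
      · rw [Real.norm_of_nonneg (le_min (abs_nonneg _) zero_le_one)]
        exact min_le_right _ _
      · filter_upwards [hlim] with ω hω
        have := ((hω.sub_const (f ω)).abs).min (tendsto_const_nhds (x := (1 : ℝ)))
        simpa using this
    rw [integral_zero] at h
    exact hD.mem_of_tendsto (tendsto_iff_dist_tendsto_zero.2 h) (Eventually.of_forall hu)
  · intro hD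
    refine isSeqClosed_iff_isClosed.1 fun u f hu hlim => ?_
    have h1 : ∀ k : ℕ, ∀ᶠ n in atTop, dist (u n) f ≤ (1 / 2) ^ k := fun k =>
      (tendsto_iff_dist_tendsto_zero.1 hlim).eventually_le_const (by positivity)
    choose φ hφ using fun k => (h1 k).exists
    refine hD (fun k => u (φ k)) f (fun k => hu _) ?_
    have h2 := ae_summable_of_tsum_lintegral
      (fun k => aemeasurable_min_abs_sub (u (φ k)) f)
      (fun k ω => le_min (abs_nonneg _) zero_le_one) (tsum_ne_top_of_le_geometric fun k => by
        rw [lzero_dist_lintegral]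
        exact ENNReal.ofReal_le_ofReal (hφ k))
    filter_upwards [h2] with ω hω
    exact tendsto_sub_nhds_zero_iff.1 (tendsto_zero_of_min_one hω.tendsto_atTop_zero)

/-- A sequence that is Cauchy in probability has an a.e. convergent subsequence. -/
theorem exists_subseq_ae_tendsto (u : ℕ → Ω →ₘ[P] ℝ)
    (hu : ∀ ε : ℝ, 0 < ε → ∃ N, ∀ k l, N ≤ k → k ≤ l →
      ∫⁻ ω, ENNReal.ofReal (min |u l ω - u k ω| 1) ∂P ≤ ENNReal.ofReal ε) :
    ∃ φ : ℕ → ℕ, StrictMono φ ∧ ∃ f : Ω →ₘ[P] ℝ,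
      ∀ᵐ ω ∂P, Tendsto (fun k => u (φ k) ω) atTop (𝓝 (f ω)) := by
  have h1 : ∀ n : ℕ, ∀ᶠ k in atTop, ∀ l, k ≤ l →
      ∫⁻ ω, ENNReal.ofReal (min |u l ω - u k ω| 1) ∂P ≤ ENNReal.ofReal ((1 / 2) ^ n) := by
    intro n
    obtain ⟨N, hN⟩ := hu ((1 / 2) ^ n) (by positivity)
    filter_upwards [eventually_ge_atTop N] with k hk l hl using hN k l hk hl
  obtain ⟨φ, hφ, h2⟩ := extraction_forall_of_eventually h1
  have h3 := ae_summable_of_tsum_lintegral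
    (fun k => aemeasurable_min_abs_sub (u (φ (k + 1))) (u (φ k)))
    (fun k ω => le_min (abs_nonneg _) zero_le_one)
    (tsum_ne_top_of_le_geometric fun k => h2 k _ (hφ.monotone k.le_succ))
  have h4 : ∀ᵐ ω ∂P, ∃ l, Tendsto (fun k => u (φ k) ω) atTop (𝓝 l) := by
    filter_upwards [h3] with ω hω
    refine cauchySeq_tendsto_of_complete (cauchySeq_of_summable_dist ?_)
    have h5 := hω.tendsto_atTop_zero.eventually_lt_const one_pos
    refine (summable_congr_atTop ?_).1 hω
    filter_upwards [h5] with k hk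
    rw [dist_comm, Real.dist_eq]
    rcases min_lt_iff.1 hk with h | h
    · exact min_eq_left h.le
    · exact absurd h (lt_irrefl _)
  obtain ⟨f, hf, hlim⟩ := exists_stronglyMeasurable_limit_of_tendsto_ae
    (fun k => (u (φ k)).aestronglyMeasurable) h4
  refine ⟨φ, hφ, AEEqFun.mk f hf.aestronglyMeasurable, ?_⟩
  filter_upwards [hlim, AEEqFun.coeFn_mk f hf.aestronglyMeasurable] with ω h6 h7
  rwa [h7]

section Modular

variable {Ψ : ℝ → ℝ}

theorem modular_mono (h : IsYoung Ψ) {f g : Ω → ℝ} (hfg : ∀ᵐ ω ∂P, |f ω| ≤ |g ω|) :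
    modular P Ψ f ≤ modular P Ψ g :=
  lintegral_mono_ae (hfg.mono fun _ hω => ENNReal.ofReal_le_ofReal (h.mono hω))

theorem modular_congr {f g : Ω → ℝ} (hfg : f =ᵐ[P] g) : modular P Ψ f = modular P Ψ g :=
  lintegral_congr_ae (hfg.mono fun ω hω => by simp only [hω])

/-- Fatou's lemma for the modular. -/
theorem modular_le_of_tendsto (h : IsYoung Ψ) {u : ℕ → Ω → ℝ} {f : Ω → ℝ} {c : ℝ≥0∞}
    (hu : ∀ k, AEMeasurable (u k) P) (hc : ∀ k, modular P Ψ (u k) ≤ c)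
    (hlim : ∀ᵐ ω ∂P, Tendsto (fun k => u k ω) atTop (𝓝 (f ω))) : modular P Ψ f ≤ c := by
  calc modular P Ψ f ≤ ∫⁻ ω, liminf (fun k => ENNReal.ofReal (Ψ (u k ω))) atTop ∂P := by
        refine lintegral_mono_ae (hlim.mono fun ω hω => ?_)
        have := (ENNReal.continuous_ofReal.tendsto _).comp ((h.continuous.tendsto _).comp hω)
        exact this.liminf_eq.ge
    _ ≤ liminf (fun k => modular P Ψ (u k)) atTop :=
        lintegral_liminf_le' fun k => (h.measurable.comp_aemeasurable (hu k)).ennreal_ofReal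
    _ ≤ c := liminf_le_of_frequently_le' (Frequently.of_forall hc)

theorem modular_combo_le (h : IsYoung Ψ) {f g : Ω → ℝ} (hf : AEMeasurable f P)
    {c : ℝ≥0∞} (hfc : modular P Ψ f ≤ c) (hgc : modular P Ψ g ≤ c)
    {a b : ℝ} (ha : 0 ≤ a) (hb : 0 ≤ b) (hab : a + b = 1) :
    modular P Ψ (fun ω => a * f ω + b * g ω) ≤ c := by
  calc modular P Ψ (fun ω => a * f ω + b * g ω)
      ≤ ∫⁻ ω, (ENNReal.ofReal a * ENNReal.ofReal (Ψ (f ω))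
          + ENNReal.ofReal b * ENNReal.ofReal (Ψ (g ω))) ∂P := by
        refine lintegral_mono fun ω => ?_
        rw [← ENNReal.ofReal_mul ha, ← ENNReal.ofReal_mul hb, ← ENNReal.ofReal_add
          (mul_nonneg ha (h.nonneg _)) (mul_nonneg hb (h.nonneg _))]
        exact ENNReal.ofReal_le_ofReal
          (h.convex.2 (Set.mem_univ (f ω)) (Set.mem_univ (g ω)) ha hb hab)
    _ = ENNReal.ofReal a * modular P Ψ f + ENNReal.ofReal b * modular P Ψ g := by
        have hm : AEMeasurable (fun ω => Ψ (f ω)) P := h.measurable.comp_aemeasurable hf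
        rw [lintegral_add_left' (hm.ennreal_ofReal.const_mul _),
          lintegral_const_mul' _ _ ENNReal.ofReal_ne_top,
          lintegral_const_mul' _ _ ENNReal.ofReal_ne_top]
        rfl
    _ ≤ ENNReal.ofReal a * c + ENNReal.ofReal b * c := by gcongr
    _ = c := by rw [← add_mul, ← ENNReal.ofReal_add ha hb, hab, ENNReal.ofReal_one, one_mul]

theorem modular_mul_le (h : IsYoung Ψ) {t : ℝ} (ht : 0 ≤ t) (ht1 : t ≤ 1) (f : Ω → ℝ) :
    modular P Ψ (fun ω => t * f ω) ≤ ENNReal.ofReal t * modular P Ψ f := by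
  rw [modular, modular, ← lintegral_const_mul' _ _ ENNReal.ofReal_ne_top]
  refine lintegral_mono fun ω => ?_
  rw [← ENNReal.ofReal_mul ht]
  exact ENNReal.ofReal_le_ofReal (h.mul_le ht ht1 _)

theorem tendsto_modular_min (h : IsYoung Ψ) {u : ℕ → Ω → ℝ} {g : Ω → ℝ}
    (hu : ∀ k, AEMeasurable (u k) P) (hg : AEMeasurable g P) (hfin : modular P Ψ g ≠ ∞)
    (hlim : ∀ᵐ ω ∂P, Tendsto (fun k => u k ω) atTop (𝓝 0)) :
    Tendsto (fun k => modular P Ψ (fun ω => min |g ω| |u k ω|)) atTop (𝓝 0) := by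
  have : Tendsto (fun k => modular P Ψ (fun ω => min |g ω| |u k ω|)) atTop
      (𝓝 (∫⁻ _, 0 ∂P)) := by
    refine tendsto_lintegral_of_dominated_convergence' _ (fun k => ?_)
      (fun k => Eventually.of_forall fun ω => ?_) hfin ?_
    · exact (h.measurable.comp_aemeasurable (by have := hu k; fun_prop)).ennreal_ofReal
    · refine ENNReal.ofReal_le_ofReal (h.mono ?_)
      rw [abs_of_nonneg (le_min (abs_nonneg _) (abs_nonneg _))]
      exact min_le_left _ _
    · filter_upwards [hlim] with ω hω
      have h1 := (tendsto_const_nhds (x := |g ω|)).min hω.abs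
      rw [abs_zero, min_eq_right (abs_nonneg _)] at h1
      have := (ENNReal.continuous_ofReal.tendsto _).comp ((h.continuous.tendsto _).comp h1)
      simpa [h.zero, Function.comp_def] using this
  simpa using this

theorem exists_lintegral_abs_le [IsProbabilityMeasure P] (h : IsYoung Ψ) :
    ∃ R : ℝ, 0 < R ∧ ∀ f : Ω → ℝ, modular P Ψ f ≤ 1 →
      ∫⁻ ω, ENNReal.ofReal |f ω| ∂P ≤ ENNReal.ofReal R := by
  obtain ⟨M, hM1, hM⟩ := h.exists_mul_le 1
  refine ⟨M + 1, by linarith, fun f hf => ?_⟩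
  calc ∫⁻ ω, ENNReal.ofReal |f ω| ∂P
      ≤ ∫⁻ ω, (ENNReal.ofReal M + ENNReal.ofReal (Ψ (f ω))) ∂P := by
        refine lintegral_mono fun ω => ?_
        rw [← ENNReal.ofReal_add (by linarith) (h.nonneg _)]
        refine ENNReal.ofReal_le_ofReal ?_
        rcases le_total M |f ω| with h1 | h1
        · linarith [hM _ h1]
        · linarith [h.nonneg (f ω)]
    _ = ENNReal.ofReal M + modular P Ψ f := by
        rw [lintegral_add_left measurable_const, lintegral_const, measure_univ, mul_one]
        rfl
    _ ≤ ENNReal.ofReal M + 1 := by gcongr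
    _ = ENNReal.ofReal (M + 1) := by
        rw [ENNReal.ofReal_add (by linarith) zero_le_one, ENNReal.ofReal_one]

/-- A modular bound upgrades a.e. convergence to convergence in mean: it gives uniform
integrability because `Ψ` is superlinear. -/
theorem tendsto_lintegral_abs [IsProbabilityMeasure P] (h : IsYoung Ψ) {u : ℕ → Ω → ℝ}
    (hu : ∀ k, AEMeasurable (u k) P) (hc : ∀ k, modular P Ψ (u k) ≤ 1)
    (hlim : ∀ᵐ ω ∂P, Tendsto (fun k => u k ω) atTop (𝓝 0)) :
    Tendsto (fun k => ∫⁻ ω, ENNReal.ofReal |u k ω| ∂P) atTop (𝓝 0) := by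
  refine ENNReal.tendsto_nhds_zero.2 fun ε hε => ?_
  obtain ⟨δ, hδ0, hδ⟩ : ∃ δ : ℝ, 0 < δ ∧ ENNReal.ofReal δ ≤ ε / 2 := by
    rcases eq_or_ne ε ∞ with rfl | hε'
    · exact ⟨1, one_pos, by simp [ENNReal.top_div]⟩
    · refine ⟨(ε / 2).toReal, ENNReal.toReal_pos (by simp [hε.ne']) ?_, ENNReal.ofReal_toReal_le⟩
      exact (ENNReal.div_lt_top hε' (by simp)).ne
  obtain ⟨M, hM1, hM⟩ := h.exists_mul_le δ⁻¹
  have h1 : Tendsto (fun k => ∫⁻ ω, ENNReal.ofReal (min |u k ω| M) ∂P) atTop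
      (𝓝 (∫⁻ _, 0 ∂P)) := by
    refine tendsto_lintegral_of_dominated_convergence' (fun _ => ENNReal.ofReal M) (fun k => ?_)
      (fun k => Eventually.of_forall fun ω => ENNReal.ofReal_le_ofReal (min_le_right _ _))
      (by simp) ?_
    · have := hu k
      fun_prop
    · filter_upwards [hlim] with ω hω
      have h1 := hω.abs.min (tendsto_const_nhds (x := M))
      rw [abs_zero, min_eq_left (by linarith)] at h1
      have := (ENNReal.continuous_ofReal.tendsto _).comp h1
      rwa [ENNReal.ofReal_zero] at this
  rw [lintegral_zero] at h1
  have hε2 : 0 < ε / 2 := by simp [hε.ne']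
  filter_upwards [h1.eventually_le_const hε2] with k hk
  calc ∫⁻ ω, ENNReal.ofReal |u k ω| ∂P
      ≤ ∫⁻ ω, (ENNReal.ofReal (min |u k ω| M)
          + ENNReal.ofReal δ * ENNReal.ofReal (Ψ (u k ω))) ∂P := by
        refine lintegral_mono fun ω => ?_
        have h2 := mul_nonneg hδ0.le (h.nonneg (u k ω))
        rw [← ENNReal.ofReal_mul hδ0.le, ← ENNReal.ofReal_add
          (le_min (abs_nonneg _) (by linarith)) h2]
        refine ENNReal.ofReal_le_ofReal ?_
        rcases le_total M |u k ω| with h3 | h3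
        · have h4 := mul_le_mul_of_nonneg_left (hM _ h3) hδ0.le
          rw [← mul_assoc, mul_inv_cancel₀ hδ0.ne', one_mul] at h4
          rw [min_eq_right h3]
          linarith
        · rw [min_eq_left h3]
          linarith
    _ = (∫⁻ ω, ENNReal.ofReal (min |u k ω| M) ∂P) + ENNReal.ofReal δ * modular P Ψ (u k) := by
        rw [lintegral_add_left' (by have := hu k; fun_prop),
          lintegral_const_mul' _ _ ENNReal.ofReal_ne_top]
        rfl
    _ ≤ ε / 2 + ε / 2 * 1 := by
        gcongr
        exact hc k
    _ = ε := by rw [mul_one, ENNReal.add_halves]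

theorem mem_orliczSpace {f : Ω →ₘ[P] ℝ} :
    f ∈ orliczSpace P Ψ ↔ ∃ c : ℝ, 0 < c ∧ modular P Ψ (fun ω => c * f ω) < ∞ := Iff.rfl

theorem modular_dilate_mono (h : IsYoung Ψ) {f : Ω → ℝ} {c c' : ℝ} (hc' : 0 ≤ c')
    (hcc : c' ≤ c) : modular P Ψ (fun ω => c' * f ω) ≤ modular P Ψ (fun ω => c * f ω) :=
  modular_mono h (Eventually.of_forall fun ω => by
    rw [abs_mul, abs_mul, abs_of_nonneg hc', abs_of_nonneg (hc'.trans hcc)]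
    gcongr)

theorem exists_modular_le_one (h : IsYoung Ψ) {f : Ω →ₘ[P] ℝ} (hf : f ∈ orliczSpace P Ψ) :
    ∃ c : ℝ, 0 < c ∧ modular P Ψ (fun ω => c * f ω) ≤ 1 := by
  obtain ⟨c, hc, hfin⟩ := mem_orliczSpace.1 hf
  set s := (modular P Ψ (fun ω => c * f ω)).toReal with hs
  have hs0 : 0 ≤ s := ENNReal.toReal_nonneg
  refine ⟨(1 + s)⁻¹ * c, by positivity, ?_⟩
  have h1 : (1 + s)⁻¹ ≤ 1 := inv_le_one_of_one_le₀ (by linarith)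
  have := modular_mul_le (P := P) h (by positivity) h1 (fun ω => c * f ω)
  simp only [← mul_assoc] at this
  refine this.trans ?_
  rw [← ENNReal.ofReal_toReal hfin.ne, ← ENNReal.ofReal_mul (by positivity), ← hs]
  refine ENNReal.ofReal_le_one.2 ?_
  rw [inv_mul_le_iff₀ (by positivity)]
  linarith

theorem mem_orliczSpace_of_abs_le (h : IsYoung Ψ) {f g : Ω →ₘ[P] ℝ} (hg : g ∈ orliczSpace P Ψ)
    (hfg : ∀ᵐ ω ∂P, |f ω| ≤ |g ω|) : f ∈ orliczSpace P Ψ := by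
  obtain ⟨c, hc, hfin⟩ := hg
  refine ⟨c, hc, lt_of_le_of_lt (modular_mono h ?_) hfin⟩
  filter_upwards [hfg] with ω hω
  rw [abs_mul, abs_mul]
  gcongr

theorem add_mem_orliczSpace (h : IsYoung Ψ) {f g : Ω →ₘ[P] ℝ} (hf : f ∈ orliczSpace P Ψ)
    (hg : g ∈ orliczSpace P Ψ) : f + g ∈ orliczSpace P Ψ := by
  obtain ⟨c, hc, h1⟩ := exists_modular_le_one h hf
  obtain ⟨d, hd, h2⟩ := exists_modular_le_one h hg
  have hm : 0 < min c d := lt_min hc hd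
  refine ⟨1 / 2 * min c d, by positivity, lt_of_le_of_lt ?_ ENNReal.one_lt_top⟩
  have h3 := modular_combo_le (P := P) h (f.aemeasurable.const_mul (min c d))
    ((modular_dilate_mono h hm.le (min_le_left _ _)).trans h1)
    ((modular_dilate_mono h hm.le (min_le_right _ _)).trans h2)
    (by norm_num : (0 : ℝ) ≤ 1 / 2) (by norm_num : (0 : ℝ) ≤ 1 / 2) (by norm_num)
  refine le_trans (le_of_eq (modular_congr ?_)) h3
  filter_upwards [AEEqFun.coeFn_add f g] with ω hω
  rw [hω, Pi.add_apply]
  ring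

theorem smul_mem_orliczSpace {f : Ω →ₘ[P] ℝ} (h : IsYoung Ψ) (hf : f ∈ orliczSpace P Ψ) (a : ℝ) :
    a • f ∈ orliczSpace P Ψ := by
  obtain ⟨c, hc, h1⟩ := hf
  have ha : 0 < 1 + |a| := by positivity
  refine ⟨c / (1 + |a|), by positivity, lt_of_le_of_lt (modular_mono h ?_) h1⟩
  filter_upwards [AEEqFun.coeFn_smul a f] with ω hω
  rw [hω, Pi.smul_apply, smul_eq_mul, abs_mul, abs_mul, abs_mul, abs_div, abs_of_pos ha,
    abs_of_pos hc, div_mul_eq_mul_div, div_le_iff₀ ha]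
  have := mul_nonneg hc.le (abs_nonneg (f ω))
  nlinarith [abs_nonneg a]

end Modular

/-! ### Order bounded convex combinations -/

theorem IsYoung.sum_le {Ψ : ℝ → ℝ} (h : IsYoung Ψ) {ι : Type*} (t : Finset ι) (w x : ι → ℝ)
    (hw : ∀ i ∈ t, 0 ≤ w i) (hw1 : ∑ i ∈ t, w i ≤ 1) :
    Ψ (∑ i ∈ t, w i * x i) ≤ ∑ i ∈ t, w i * Ψ (x i) := by
  have := h.convex.map_add_sum_le (t := t) (w := w) (p := x) (v := 1 - ∑ i ∈ t, w i) (q := 0) hw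
    (by ring) (fun _ _ => Set.mem_univ _) (by linarith) (Set.mem_univ _)
  simpa [h.zero] using this

/-- The average of `N` numbers is controlled by the largest one divided by `N`
together with the pairwise minima, since all but the largest are such minima. -/
theorem IsYoung.half_avg_le {Ψ : ℝ → ℝ} (h : IsYoung Ψ) {N : ℕ} (hN : 0 < N) (x : ℕ → ℝ) :
    Ψ (1 / 2 * ((∑ i ∈ Finset.range N, x i) / N)) ≤ ∑ i ∈ Finset.range N, Ψ (x i / N)
      + ∑ i ∈ Finset.range N, ∑ j ∈ (Finset.range N).erase i, Ψ (min (x i) (x j)) := by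
  have hN' : (1 : ℝ) ≤ N := by exact_mod_cast hN
  obtain ⟨j, hj, hmax⟩ := Finset.exists_max_image (Finset.range N) x
    (Finset.nonempty_range_iff.2 hN.ne')
  have h1 : 1 / 2 * ((∑ i ∈ Finset.range N, x i) / N)
      = (x j / N + ∑ i ∈ (Finset.range N).erase j, (N : ℝ)⁻¹ * min (x j) (x i)) / 2 := by
    rw [← Finset.add_sum_erase _ _ hj, ← Finset.mul_sum,
      Finset.sum_congr rfl fun i hi => min_eq_right (hmax i (Finset.mem_of_mem_erase hi))]
    ring
  have h2 : Ψ (∑ i ∈ (Finset.range N).erase j, (N : ℝ)⁻¹ * min (x j) (x i))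
      ≤ ∑ i ∈ (Finset.range N).erase j, Ψ (min (x j) (x i)) := by
    refine (h.sum_le _ _ _ (fun _ _ => by positivity) ?_).trans (Finset.sum_le_sum fun i _ =>
      mul_le_of_le_one_left (h.nonneg _) (inv_le_one_of_one_le₀ hN'))
    rw [Finset.sum_const, nsmul_eq_mul, ← div_eq_mul_inv, div_le_one (by linarith)]
    exact_mod_cast (Finset.card_erase_le).trans (Finset.card_range N).le
  have h3 : Ψ (x j / N) ≤ ∑ i ∈ Finset.range N, Ψ (x i / N) :=
    Finset.single_le_sum (f := fun i => Ψ (x i / N)) (fun _ _ => h.nonneg _) hj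
  have h4 : ∑ i ∈ (Finset.range N).erase j, Ψ (min (x j) (x i))
      ≤ ∑ i ∈ Finset.range N, ∑ j ∈ (Finset.range N).erase i, Ψ (min (x i) (x j)) :=
    Finset.single_le_sum
      (f := fun i => ∑ j ∈ (Finset.range N).erase i, Ψ (min (x i) (x j)))
      (fun _ _ => Finset.sum_nonneg fun _ _ => h.nonneg _) hj
  have h5 := h.le_midpoint (x j / N)
    (∑ i ∈ (Finset.range N).erase j, (N : ℝ)⁻¹ * min (x j) (x i))
  have h6 := h.nonneg (x j / N)
  have h7 := h.nonneg (∑ i ∈ (Finset.range N).erase j, (N : ℝ)⁻¹ * min (x j) (x i))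
  rw [h1]
  linarith

/-- If a sequence with bounded modular converges to `0` a.e., then suitable averages of its terms
have arbitrarily small modular. The terms of the average are chosen almost disjoint, in the sense
that the modulars of their pairwise minima are small, and the `Δ₂`-condition makes the average of
many almost disjoint terms small. -/
theorem exists_small_average [IsProbabilityMeasure P] {Φ : ℝ → ℝ} (h : IsYoung Φ)
    (hΔ : IsDeltaTwo Φ) (d : ℕ → Ω → ℝ) (hd : ∀ k, AEMeasurable (d k) P)
    (hmod : ∀ k, modular P (youngConj Φ) (d k) ≤ 1)
    (hlim : ∀ᵐ ω ∂P, Tendsto (fun k => d k ω) atTop (𝓝 0)) {ε : ℝ} (hε : 0 < ε) :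
    ∃ N : ℕ, 0 < N ∧ ∃ f : ℕ → ℕ,
      modular P (youngConj Φ) (fun ω => 1 / 2 * ((∑ i ∈ Finset.range N, |d (f i) ω|) / N))
        ≤ ENNReal.ofReal ε ∧
      ∫⁻ ω, ENNReal.ofReal (min ((∑ i ∈ Finset.range N, |d (f i) ω|) / N) 1) ∂P
        ≤ ENNReal.ofReal ε := by
  set Ψ := youngConj Φ with hΨ
  have hY : IsYoung Ψ := h.conj
  obtain ⟨N, hN, y₁, hy₁, hNy⟩ := h.exists_conj_div_le hΔ (half_pos hε)
  have hN' : (1 : ℝ) ≤ N := by exact_mod_cast hN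
  set δ : ℝ := ε / (4 * N ^ 2) with hδ
  have hδ0 : 0 < δ := by positivity
  have hδ' : (0 : ℝ≥0∞) < ENNReal.ofReal δ := ENNReal.ofReal_pos.2 hδ0
  have hev : ∀ g : Ω → ℝ, AEMeasurable g P → modular P Ψ g ≠ ∞ →
      ∀ᶠ k in atTop, modular P Ψ (fun ω => min |g ω| |d k ω|) ≤ ENNReal.ofReal δ :=
    fun g hg hfin => (tendsto_modular_min hY hd hg hfin hlim).eventually_le_const hδ'
  have hone : ∀ᶠ k in atTop, ∫⁻ ω, ENNReal.ofReal (min |d k ω| 1) ∂P ≤ ENNReal.ofReal δ := by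
    have : Tendsto (fun k => ∫⁻ ω, ENNReal.ofReal (min |d k ω| 1) ∂P) atTop (𝓝 0) := by
      refine tendsto_of_tendsto_of_tendsto_of_le_of_le tendsto_const_nhds
        (tendsto_lintegral_abs hY hd hmod hlim) (fun _ => zero_le) fun k => ?_
      exact lintegral_mono fun ω => ENNReal.ofReal_le_ofReal (min_le_left _ _)
    exact this.eventually_le_const hδ'
  have hconst : modular P Ψ (fun _ => y₁) ≠ ∞ := by simp [modular]
  let r : ℕ → ℕ → Prop := fun k l =>
    modular P Ψ (fun ω => min |d k ω| |d l ω|) ≤ ENNReal.ofReal δ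
  have : Std.Symm r := ⟨fun k l hkl => by simpa only [r, min_comm] using hkl⟩
  obtain ⟨f, hf1, hf2⟩ := exists_seq_of_forall_finset_exists' (fun k =>
    modular P Ψ (fun ω => min |y₁| |d k ω|) ≤ ENNReal.ofReal δ ∧
      ∫⁻ ω, ENNReal.ofReal (min |d k ω| 1) ∂P ≤ ENNReal.ofReal δ) r (by
    intro s _
    have h1 : ∀ᶠ k in atTop, ∀ x ∈ s, r x k := (eventually_all_finset s).2 fun x _ =>
      hev (d x) (hd x) (ne_top_of_le_ne_top ENNReal.one_ne_top (hmod x))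
    obtain ⟨k, hk1, hk2, hk3⟩ := (h1.and ((hev _ aemeasurable_const hconst).and hone)).exists
    exact ⟨k, ⟨hk2, hk3⟩, hk1⟩)
  have hm : ∀ k, AEMeasurable (fun ω => |d k ω|) P := fun k => by have := hd k; fun_prop
  have hmm : ∀ {g : Ω → ℝ}, AEMeasurable g P →
      AEMeasurable (fun ω => ENNReal.ofReal (Ψ (g ω))) P :=
    fun hg => (hY.measurable.comp_aemeasurable hg).ennreal_ofReal
  refine ⟨N, hN, f, ?_, ?_⟩
  · have hpt : ∀ ω, Ψ (1 / 2 * ((∑ i ∈ Finset.range N, |d (f i) ω|) / N)) ≤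
        ∑ i ∈ Finset.range N, (ε / 2 / N * Ψ (d (f i) ω) + Ψ (min |y₁| |d (f i) ω|)) +
        ∑ i ∈ Finset.range N, ∑ j ∈ (Finset.range N).erase i,
          Ψ (min |d (f i) ω| |d (f j) ω|) := by
      intro ω
      refine (hY.half_avg_le hN (fun i => |d (f i) ω|)).trans ?_
      gcongr with i _
      have h1 := hNy |d (f i) ω| (abs_nonneg _)
      rw [← hΨ, hY.abs] at h1
      rw [abs_of_nonneg hy₁, min_comm y₁]
      have h2 : Ψ (|d (f i) ω| / N) = (N * Ψ (|d (f i) ω| / N)) / N := by field_simp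
      rw [h2, div_le_iff₀ (by linarith)]
      refine h1.trans (le_of_eq ?_)
      field_simp
    calc modular P Ψ (fun ω => 1 / 2 * ((∑ i ∈ Finset.range N, |d (f i) ω|) / N))
        ≤ ∫⁻ ω, (∑ i ∈ Finset.range N, (ENNReal.ofReal (ε / 2 / N) * ENNReal.ofReal (Ψ (d (f i) ω))
            + ENNReal.ofReal (Ψ (min |y₁| |d (f i) ω|))) +
          ∑ i ∈ Finset.range N, ∑ j ∈ (Finset.range N).erase i,
            ENNReal.ofReal (Ψ (min |d (f i) ω| |d (f j) ω|))) ∂P := by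
          refine lintegral_mono fun ω => (ENNReal.ofReal_le_ofReal (hpt ω)).trans (le_of_eq ?_)
          have hn := hY.nonneg
          have hc : 0 ≤ ε / 2 / N := by positivity
          rw [ENNReal.ofReal_add
            (Finset.sum_nonneg fun i _ => add_nonneg (mul_nonneg hc (hn _)) (hn _))
            (Finset.sum_nonneg fun i _ => Finset.sum_nonneg fun j _ => hn _),
            ENNReal.ofReal_sum_of_nonneg fun i _ => add_nonneg (mul_nonneg hc (hn _)) (hn _),
            ENNReal.ofReal_sum_of_nonneg fun i _ => Finset.sum_nonneg fun j _ => hn _]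
          congr 1
          · refine Finset.sum_congr rfl fun i _ => ?_
            rw [ENNReal.ofReal_add (mul_nonneg hc (hn _)) (hn _), ENNReal.ofReal_mul hc]
          · exact Finset.sum_congr rfl fun i _ => ENNReal.ofReal_sum_of_nonneg fun j _ => hn _
      _ = ∑ i ∈ Finset.range N, (ENNReal.ofReal (ε / 2 / N) * modular P Ψ (d (f i))
            + modular P Ψ (fun ω => min |y₁| |d (f i) ω|)) +
          ∑ i ∈ Finset.range N, ∑ j ∈ (Finset.range N).erase i,
            modular P Ψ (fun ω => min |d (f i) ω| |d (f j) ω|) := by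
          have hA : ∀ i, AEMeasurable (fun ω => ENNReal.ofReal (ε / 2 / N) *
              ENNReal.ofReal (Ψ (d (f i) ω))) P := fun i => (hmm (hd _)).const_mul _
          have hB : ∀ i, AEMeasurable (fun ω => ENNReal.ofReal (Ψ (min |y₁| |d (f i) ω|))) P :=
            fun i => hmm (aemeasurable_const.min (hm _))
          have hC : ∀ i j, AEMeasurable (fun ω =>
              ENNReal.ofReal (Ψ (min |d (f i) ω| |d (f j) ω|))) P :=
            fun i j => hmm ((hm _).min (hm _))
          have hAB : ∀ i, AEMeasurable (fun ω => ENNReal.ofReal (ε / 2 / N) *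
              ENNReal.ofReal (Ψ (d (f i) ω)) + ENNReal.ofReal (Ψ (min |y₁| |d (f i) ω|))) P :=
            fun i => (hA i).add (hB i)
          rw [lintegral_add_left' (Finset.aemeasurable_fun_sum _ fun i _ => hAB i),
            lintegral_finsetSum' _ fun i _ => hAB i,
            lintegral_finsetSum' _ fun i _ => Finset.aemeasurable_fun_sum _ fun j _ => hC i j]
          congr 1
          · refine Finset.sum_congr rfl fun i _ => ?_
            rw [lintegral_add_left' (hA i), lintegral_const_mul' _ _ ENNReal.ofReal_ne_top]
            rfl
          · exact Finset.sum_congr rfl fun i _ => lintegral_finsetSum' _ fun j _ => hC i j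
      _ ≤ ∑ i ∈ Finset.range N, (ENNReal.ofReal (ε / 2 / N) * 1 + ENNReal.ofReal δ) +
          ∑ i ∈ Finset.range N, ∑ j ∈ Finset.range N, ENNReal.ofReal δ := by
          gcongr with i _ i _
          · exact hmod _
          · exact (hf1 i).1
          · refine (Finset.sum_le_sum fun j hj => hf2 (Finset.ne_of_mem_erase hj).symm).trans ?_
            exact Finset.sum_le_sum_of_subset (Finset.erase_subset _ _)
      _ ≤ ENNReal.ofReal ε := by
          have hc : 0 ≤ ε / 2 / N := by positivity
          simp only [mul_one, ← ENNReal.ofReal_add hc hδ0.le, Finset.sum_const, Finset.card_range,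
            ← ENNReal.ofReal_nsmul]
          rw [← ENNReal.ofReal_add (by positivity) (by positivity)]
          refine ENNReal.ofReal_le_ofReal ?_
          simp only [nsmul_eq_mul]
          have h1 : (N : ℝ) * (ε / 2 / N + δ) + N * (N * δ) = ε / 2 + N * δ + ε / 4 := by
            rw [hδ]
            field_simp
          have h2 : N * δ ≤ ε / 4 := by
            have : N * δ = ε / 4 / N := by
              rw [hδ]
              field_simp
            rw [this]
            exact div_le_self (by positivity) hN'
          linarith
  · have hpt : ∀ ω, min ((∑ i ∈ Finset.range N, |d (f i) ω|) / N) 1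
        ≤ ∑ i ∈ Finset.range N, min |d (f i) ω| 1 := by
      intro ω
      have hn : ∀ i ∈ Finset.range N, 0 ≤ min |d (f i) ω| 1 :=
        fun _ _ => le_min (abs_nonneg _) zero_le_one
      by_cases hall : ∀ i ∈ Finset.range N, |d (f i) ω| ≤ 1
      · refine (min_le_left _ _).trans ((div_le_self (Finset.sum_nonneg fun _ _ =>
          abs_nonneg _) hN').trans (Finset.sum_le_sum fun i hi => ?_))
        exact le_min le_rfl (hall i hi)
      · push Not at hall
        obtain ⟨i, hi, h1⟩ := hall
        refine (min_le_right _ _).trans (le_trans ?_ (Finset.single_le_sum hn hi))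
        exact le_min h1.le le_rfl
    calc ∫⁻ ω, ENNReal.ofReal (min ((∑ i ∈ Finset.range N, |d (f i) ω|) / N) 1) ∂P
        ≤ ∫⁻ ω, ∑ i ∈ Finset.range N, ENNReal.ofReal (min |d (f i) ω| 1) ∂P := by
          refine lintegral_mono fun ω => ?_
          rw [← ENNReal.ofReal_sum_of_nonneg fun _ _ => le_min (abs_nonneg _) zero_le_one]
          exact ENNReal.ofReal_le_ofReal (hpt ω)
      _ = ∑ i ∈ Finset.range N, ∫⁻ ω, ENNReal.ofReal (min |d (f i) ω| 1) ∂P :=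
          lintegral_finsetSum' _ fun i _ => ((hm _).min aemeasurable_const).ennreal_ofReal
      _ ≤ ∑ i ∈ Finset.range N, ENNReal.ofReal δ := Finset.sum_le_sum fun i _ => (hf1 i).2
      _ ≤ ENNReal.ofReal ε := by
          rw [Finset.sum_const, Finset.card_range, ← ENNReal.ofReal_nsmul]
          refine ENNReal.ofReal_le_ofReal ?_
          rw [nsmul_eq_mul, hδ, mul_div_assoc', div_le_iff₀ (by positivity)]
          have : (N : ℝ) ≤ N ^ 2 := by nlinarith
          nlinarith

theorem coeFn_sum_smul {ι : Type*} (t : Finset ι) (w : ι → ℝ) (u : ι → Ω →ₘ[P] ℝ) :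
    ∀ᵐ ω ∂P, (∑ i ∈ t, w i • u i : Ω →ₘ[P] ℝ) ω = ∑ i ∈ t, w i * u i ω := by
  classical
  induction t using Finset.induction_on with
  | empty =>
    filter_upwards [AEEqFun.coeFn_zero (μ := P) (β := ℝ)] with ω hω
    simpa using hω
  | insert a s ha ih =>
    rw [Finset.sum_insert ha]
    filter_upwards [ih, AEEqFun.coeFn_add (w a • u a) (∑ i ∈ s, w i • u i),
      AEEqFun.coeFn_smul (w a) (u a)] with ω h1 h2 h3
    rw [Finset.sum_insert ha, h2, Pi.add_apply, h1, h3, Pi.smul_apply, smul_eq_mul]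

/-- A sequence of a convex set that converges a.e. with bounded modular has convex combinations
with the same limit that are dominated by one element of the Orlicz space. -/
theorem exists_dominated_combinations [IsProbabilityMeasure P] {Φ : ℝ → ℝ} (h : IsYoung Φ)
    (hΔ : IsDeltaTwo Φ) {C : Set (Ω →ₘ[P] ℝ)} (hC : Convex ℝ C) (u : ℕ → Ω →ₘ[P] ℝ)
    (hu : ∀ k, u k ∈ C) (f : Ω →ₘ[P] ℝ)
    (hlim : ∀ᵐ ω ∂P, Tendsto (fun k => u k ω) atTop (𝓝 (f ω))) {c : ℝ} (hc : 0 < c)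
    (hmod : ∀ k, modular P (youngConj Φ) (fun ω => c * u k ω) ≤ 1) :
    ∃ v : ℕ → Ω →ₘ[P] ℝ, (∀ m, v m ∈ C) ∧
      (∀ᵐ ω ∂P, Tendsto (fun m => v m ω) atTop (𝓝 (f ω))) ∧
      ∃ ζ ∈ orliczSpace P (youngConj Φ), ∀ m, ∀ᵐ ω ∂P, |v m ω| ≤ ζ ω := by
  set Ψ := youngConj Φ with hΨ
  have hY : IsYoung Ψ := h.conj
  have huc : ∀ k, AEMeasurable (fun ω => c * u k ω) P := fun k => (u k).aemeasurable.const_mul c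
  have hfmod : modular P Ψ (fun ω => c * f ω) ≤ 1 :=
    modular_le_of_tendsto hY huc hmod (hlim.mono fun ω hω => hω.const_mul c)
  let d : ℕ → Ω → ℝ := fun k ω => c / 2 * (u k ω - f ω)
  have hd : ∀ k, AEMeasurable (d k) P := fun k =>
    ((u k).aemeasurable.sub f.aemeasurable).const_mul _
  have hdmod : ∀ k, modular P Ψ (d k) ≤ 1 := by
    intro k
    have hneg : modular P Ψ (fun ω => -(c * f ω)) ≤ 1 := by
      simpa only [modular, hY.even] using hfmod
    refine le_trans (le_of_eq (congrArg _ (funext fun ω => ?_)))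
      (modular_combo_le hY (huc k) (hmod k) hneg (by norm_num : (0 : ℝ) ≤ 1 / 2)
        (by norm_num : (0 : ℝ) ≤ 1 / 2) (by norm_num))
    simp only [d]
    ring
  have hdlim : ∀ᵐ ω ∂P, Tendsto (fun k => d k ω) atTop (𝓝 0) := by
    filter_upwards [hlim] with ω hω
    simpa using (hω.sub_const (f ω)).const_mul (c / 2)
  have hsmall := fun m : ℕ => exists_small_average h hΔ d hd hdmod hdlim
    (by positivity : (0 : ℝ) < (1 / 2) ^ m)
  choose N hN g hg1 hg2 using hsmall
  let A : ℕ → Ω → ℝ := fun m ω => (∑ i ∈ Finset.range (N m), |d (g m i) ω|) / N m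
  have hA : ∀ m, AEMeasurable (A m) P := fun m =>
    (Finset.aemeasurable_fun_sum _ fun i _ => continuous_abs.measurable.comp_aemeasurable
      (hd _)).div_const _
  have hA0 : ∀ m ω, 0 ≤ A m ω := fun m ω =>
    div_nonneg (Finset.sum_nonneg fun _ _ => abs_nonneg _) (Nat.cast_nonneg _)
  have hAlim : ∀ᵐ ω ∂P, Tendsto (fun m => A m ω) atTop (𝓝 0) := by
    have h1 := ae_summable_of_tsum_lintegral (g := fun m ω => min (A m ω) 1)
      (fun m => (hA m).min aemeasurable_const) (fun m ω => le_min (hA0 m ω) zero_le_one)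
      (tsum_ne_top_of_le_geometric hg2)
    filter_upwards [h1] with ω hω
    refine tendsto_zero_of_min_one ?_
    simpa only [abs_of_nonneg (hA0 _ ω)] using hω.tendsto_atTop_zero
  let v : ℕ → Ω →ₘ[P] ℝ := fun m => ∑ i ∈ Finset.range (N m), (N m : ℝ)⁻¹ • u (g m i)
  have hv : ∀ m, v m ∈ C := fun m => by
    refine hC.sum_mem (fun _ _ => by positivity) ?_ fun i _ => hu _
    rw [Finset.sum_const, Finset.card_range, nsmul_eq_mul, mul_inv_cancel₀]
    exact_mod_cast (hN m).ne'
  have hvA : ∀ᵐ ω ∂P, ∀ m, |v m ω - f ω| ≤ 2 / c * A m ω := by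
    refine ae_all_iff.2 fun m => ?_
    filter_upwards [coeFn_sum_smul (Finset.range (N m)) (fun _ => (N m : ℝ)⁻¹)
      (fun i => u (g m i))] with ω hω
    have hNm : (N m : ℝ) ≠ 0 := by exact_mod_cast (hN m).ne'
    have h1 : v m ω - f ω = 2 / c * ((∑ i ∈ Finset.range (N m), d (g m i) ω) / N m) := by
      simp only [v, d]
      rw [hω, ← Finset.mul_sum, ← Finset.mul_sum, Finset.sum_sub_distrib, Finset.sum_const,
        Finset.card_range, nsmul_eq_mul]
      field_simp
    rw [h1, abs_mul, abs_of_pos (by positivity : 0 < 2 / c), abs_div, Nat.abs_cast]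
    simp only [A]
    gcongr
    exact Finset.abs_sum_le_sum_abs _ _
  have hbdd : ∀ᵐ ω ∂P, BddAbove (Set.range fun m => A m ω) := by
    filter_upwards [hAlim] with ω hω using hω.bddAbove_range
  let Z : Ω → ℝ := fun ω => ⨆ m, A m ω
  have hZ : AEMeasurable Z P := AEMeasurable.iSup hA
  have hZ0 : ∀ ω, 0 ≤ Z ω := fun ω => Real.iSup_nonneg fun m => hA0 m ω
  -- the modular of the supremum is at most the sum of the modulars
  have hZmod : modular P Ψ (fun ω => 1 / 2 * Z ω) < ∞ := by
    calc modular P Ψ (fun ω => 1 / 2 * Z ω)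
        ≤ ∫⁻ ω, ∑' m, ENNReal.ofReal (Ψ (1 / 2 * A m ω)) ∂P := by
          refine lintegral_mono_ae ?_
          filter_upwards [hbdd] with ω hω
          have hcl : IsClosed {y : ℝ | ENNReal.ofReal (Ψ (1 / 2 * y))
              ≤ ∑' m, ENNReal.ofReal (Ψ (1 / 2 * A m ω))} := by
            have := hY.continuous
            exact isClosed_le (ENNReal.continuous_ofReal.comp (by fun_prop)) continuous_const
          have := closure_minimal (s := Set.range fun m => A m ω) (by
            rintro _ ⟨m, rfl⟩
            exact ENNReal.le_tsum m) hcl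
          exact this (csSup_mem_closure (Set.range_nonempty _) hω)
      _ = ∑' m, modular P Ψ (fun ω => 1 / 2 * A m ω) :=
          lintegral_tsum fun m => (hY.measurable.comp_aemeasurable
            ((hA m).const_mul _)).ennreal_ofReal
      _ < ∞ := (tsum_ne_top_of_le_geometric hg1).lt_top
  let Zc : Ω →ₘ[P] ℝ := AEEqFun.mk Z hZ.aestronglyMeasurable
  have hZc : Zc =ᵐ[P] Z := AEEqFun.coeFn_mk _ _
  have hZmem : Zc ∈ orliczSpace P Ψ := by
    refine ⟨1 / 2, by norm_num, ?_⟩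
    have := modular_congr (P := P) (Ψ := Ψ) (hZc.mono fun ω hω => by simp only [hω] :
      (fun ω => 1 / 2 * Zc ω) =ᵐ[P] fun ω => 1 / 2 * Z ω)
    exact this.trans_lt hZmod
  have hfmem : |f| ∈ orliczSpace P Ψ := by
    refine mem_orliczSpace_of_abs_le hY (g := f) ⟨c, hc, hfmod.trans_lt ENNReal.one_lt_top⟩ ?_
    filter_upwards [AEEqFun.coeFn_abs f] with ω hω
    rw [hω, abs_abs]
  refine ⟨v, hv, ?_, (2 / c) • Zc + |f|,
    add_mem_orliczSpace hY (smul_mem_orliczSpace hY hZmem _) hfmem, fun m => ?_⟩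
  · filter_upwards [hvA, hAlim] with ω h1 h2
    refine tendsto_sub_nhds_zero_iff.1 (squeeze_zero_norm h1 ?_)
    simpa using h2.const_mul (2 / c)
  · filter_upwards [hvA, hbdd, hZc, AEEqFun.coeFn_add ((2 / c) • Zc) |f|,
      AEEqFun.coeFn_smul (2 / c) Zc, AEEqFun.coeFn_abs f] with ω h1 h2 h3 h4 h5 h6
    rw [h4, Pi.add_apply, h5, h6, Pi.smul_apply, smul_eq_mul, h3]
    have h7 : A m ω ≤ Z ω := le_ciSup h2 m
    have h8 : 2 / c * A m ω ≤ 2 / c * Z ω := by gcongr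
    have h9 := abs_add_le (v m ω - f ω) (f ω)
    rw [sub_add_cancel] at h9
    linarith [h1 m]

/-! ### Nested convex sets of random variables -/

/-- Quantitative strict convexity of `x ↦ √(1 + x²)`. -/
theorem sq_sub_le_sqrt_gap {M x y : ℝ} (hM : 1 + |x| + |y| ≤ M) :
    (x - y) ^ 2 ≤ 12 * M ^ 3 *
      ((√(1 + x ^ 2) + √(1 + y ^ 2)) / 2 - √(1 + ((x + y) / 2) ^ 2)) := by
  have hle : ∀ z : ℝ, √(1 + z ^ 2) ≤ 1 + |z| := fun z => by
    rw [Real.sqrt_le_left (by positivity)]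
    nlinarith [abs_nonneg z, sq_abs z]
  have hx := hle x
  have hy := hle y
  have hz := hle ((x + y) / 2)
  have hxy : |(x + y) / 2| ≤ |x| + |y| := by
    rw [abs_div, abs_two]
    linarith [abs_add_le x y, abs_nonneg x, abs_nonneg y]
  have ha2 := Real.sq_sqrt (by positivity : 0 ≤ 1 + x ^ 2)
  have hb2 := Real.sq_sqrt (by positivity : 0 ≤ 1 + y ^ 2)
  have hc2 := Real.sq_sqrt (by positivity : 0 ≤ 1 + ((x + y) / 2) ^ 2)
  have ha0 : 1 ≤ √(1 + x ^ 2) := Real.one_le_sqrt.2 (by nlinarith)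
  have hb0 : 1 ≤ √(1 + y ^ 2) := Real.one_le_sqrt.2 (by nlinarith)
  have hc0 := Real.sqrt_nonneg (1 + ((x + y) / 2) ^ 2)
  generalize √(1 + x ^ 2) = a at *
  generalize √(1 + y ^ 2) = b at *
  generalize √(1 + ((x + y) / 2) ^ 2) = c at *
  have hx0 := abs_nonneg x
  have hy0 := abs_nonneg y
  have haM : a ≤ M := by linarith
  have hbM : b ≤ M := by linarith
  have hcM : c ≤ M := by linarith
  have hM1 : 1 ≤ M := by linarith
  have hxyM : x * y ≤ M * M :=
    (le_abs_self _).trans (by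
      rw [abs_mul]
      exact mul_le_mul (by linarith) (by linarith) hy0 (by linarith))
  have hab : -(a * b) ≤ 1 + x * y ∧ 1 + x * y ≤ a * b := by
    have h1 : (1 + x * y) ^ 2 ≤ (a * b) ^ 2 := by
      rw [mul_pow, ha2, hb2]
      nlinarith [sq_nonneg (x - y)]
    exact abs_le_of_sq_le_sq' h1 (by positivity)
  obtain ⟨hab', hab⟩ := hab
  have h1 : ((a + b) / 2 - c) * ((a + b) / 2 + c) = (a * b - 1 - x * y) / 2 := by
    linear_combination (1 / 4) * ha2 + (1 / 4) * hb2 - hc2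
  have h2 : (a * b - 1 - x * y) * (a * b + 1 + x * y) = (x - y) ^ 2 := by
    linear_combination (b ^ 2) * ha2 + (1 + x ^ 2) * hb2
  have hG : 0 ≤ (a + b) / 2 - c := by
    have : 0 ≤ ((a + b) / 2 - c) * ((a + b) / 2 + c) := by rw [h1]; linarith
    exact nonneg_of_mul_nonneg_left this (by linarith)
  have h3 : (a + b) / 2 + c ≤ 2 * M := by linarith
  have h4 : a * b + 1 + x * y ≤ 3 * M ^ 2 := by
    have := mul_le_mul haM hbM (by linarith) (by linarith)
    have := mul_le_mul hM1 hM1 zero_le_one (by linarith)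
    linarith
  calc (x - y) ^ 2
      = 2 * (((a + b) / 2 - c) * ((a + b) / 2 + c)) * (a * b + 1 + x * y) := by
        rw [h1, ← h2]; ring
    _ ≤ 2 * (((a + b) / 2 - c) * (2 * M)) * (a * b + 1 + x * y) := by
        refine mul_le_mul_of_nonneg_right ?_ (by linarith)
        have := mul_le_mul_of_nonneg_left h3 hG
        linarith
    _ ≤ 2 * (((a + b) / 2 - c) * (2 * M)) * (3 * M ^ 2) := by
        refine mul_le_mul_of_nonneg_left h4 ?_
        have : 0 ≤ ((a + b) / 2 - c) * (2 * M) := mul_nonneg hG (by linarith)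
        linarith
    _ = _ := by ring

theorem exists_min_abs_sub_le {t : ℝ} (ht : 0 < t) : ∃ K : ℝ, 0 ≤ K ∧ ∀ x y : ℝ,
    min |x - y| 1 ≤ t * (1 + |x| + |y|) + K *
      ((√(1 + x ^ 2) + √(1 + y ^ 2)) / 2 - √(1 + ((x + y) / 2) ^ 2)) := by
  refine ⟨12 * t⁻¹ ^ 3 / t, by positivity, fun x y => ?_⟩
  rcases le_total (1 + |x| + |y|) t⁻¹ with h | h
  · have h1 := sq_sub_le_sqrt_gap h
    have h2 : |x - y| ≤ t + (x - y) ^ 2 / t := by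
      rw [← sub_le_iff_le_add', le_div_iff₀ ht, ← sq_abs (x - y)]
      nlinarith [sq_nonneg (|x - y| - t), abs_nonneg (x - y)]
    have h3 := div_le_div_of_nonneg_right h1 ht.le
    have h4 : t ≤ t * (1 + |x| + |y|) :=
      le_mul_of_one_le_right ht.le (by linarith [abs_nonneg x, abs_nonneg y])
    calc min |x - y| 1 ≤ |x - y| := min_le_left _ _
      _ ≤ t * (1 + |x| + |y|) + (12 * t⁻¹ ^ 3 *
        ((√(1 + x ^ 2) + √(1 + y ^ 2)) / 2 - √(1 + ((x + y) / 2) ^ 2))) / t := by linarith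
      _ = _ := by ring
  · have h1 := sq_sub_le_sqrt_gap (le_refl (1 + |x| + |y|))
    have h2 : 0 ≤ (√(1 + x ^ 2) + √(1 + y ^ 2)) / 2 - √(1 + ((x + y) / 2) ^ 2) :=
      nonneg_of_mul_nonneg_right ((sq_nonneg _).trans h1) (by positivity)
    have h3 : 1 ≤ t * (1 + |x| + |y|) := by
      have := mul_le_mul_of_nonneg_left h ht.le
      rwa [mul_inv_cancel₀ ht.ne'] at this
    have h4 : 0 ≤ 12 * t⁻¹ ^ 3 / t * ((√(1 + x ^ 2) + √(1 + y ^ 2)) / 2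
      - √(1 + ((x + y) / 2) ^ 2)) := mul_nonneg (by positivity) h2
    linarith [min_le_right |x - y| 1]

theorem integrable_of_lintegral_abs_le {f : Ω →ₘ[P] ℝ} {R : ℝ}
    (h : ∫⁻ ω, ENNReal.ofReal |f ω| ∂P ≤ ENNReal.ofReal R) : Integrable f P := by
  refine ⟨f.aestronglyMeasurable, ?_⟩
  rw [hasFiniteIntegral_iff_norm]
  exact h.trans_lt ENNReal.ofReal_lt_top

theorem integral_abs_le {f : Ω →ₘ[P] ℝ} {R : ℝ} (hR : 0 ≤ R)
    (h : ∫⁻ ω, ENNReal.ofReal |f ω| ∂P ≤ ENNReal.ofReal R) : ∫ ω, |f ω| ∂P ≤ R := by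
  rw [integral_eq_lintegral_of_nonneg_ae (Eventually.of_forall fun _ => abs_nonneg _)
    f.aestronglyMeasurable.norm]
  exact ENNReal.toReal_le_of_le_ofReal hR h

/-- In a decreasing sequence of nonempty convex sets of random variables that is bounded in mean,
one can select elements that converge a.e. They are chosen to nearly minimise `E[√(1 + ξ²)]`;
strict convexity makes such a selection Cauchy in probability. -/
theorem exists_ae_tendsto_of_antitone [IsProbabilityMeasure P] {S : ℕ → Set (Ω →ₘ[P] ℝ)}
    (hS : Antitone S) (hconv : ∀ k, Convex ℝ (S k)) (hne : ∀ k, (S k).Nonempty) {R : ℝ}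
    (hR0 : 0 ≤ R) (hR : ∀ ξ ∈ S 0, ∫⁻ ω, ENNReal.ofReal |ξ ω| ∂P ≤ ENNReal.ofReal R) :
    ∃ (v : ℕ → Ω →ₘ[P] ℝ) (f : Ω →ₘ[P] ℝ), (∀ k, v k ∈ S k) ∧
      ∀ᵐ ω ∂P, Tendsto (fun k => v k ω) atTop (𝓝 (f ω)) := by
  have hR' : ∀ {k ξ}, ξ ∈ S k → ∫⁻ ω, ENNReal.ofReal |ξ ω| ∂P ≤ ENNReal.ofReal R :=
    fun hξ => hR _ (hS (Nat.zero_le _) hξ)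
  let J : (Ω →ₘ[P] ℝ) → ℝ := fun ξ => ∫ ω, √(1 + (ξ ω) ^ 2) ∂P
  have hsqrt : ∀ z : ℝ, √(1 + z ^ 2) ≤ 1 + |z| := fun z => by
    rw [Real.sqrt_le_left (by positivity)]
    nlinarith [abs_nonneg z, sq_abs z]
  have hJint : ∀ {k ξ}, ξ ∈ S k → Integrable (fun ω => √(1 + (ξ ω) ^ 2)) P := by
    intro k ξ hξ
    refine ((integrable_const 1).add (integrable_of_lintegral_abs_le (hR' hξ)).abs).mono' ?_
      (Eventually.of_forall fun ω => ?_)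
    · have := ξ.aestronglyMeasurable
      fun_prop
    · rw [Real.norm_of_nonneg (Real.sqrt_nonneg _)]
      exact hsqrt _
  have hJle : ∀ {k ξ}, ξ ∈ S k → J ξ ≤ 1 + R := by
    intro k ξ hξ
    have hi := integrable_of_lintegral_abs_le (hR' hξ)
    calc J ξ ≤ ∫ ω, (1 + |ξ ω|) ∂P :=
          integral_mono (hJint hξ) ((integrable_const 1).add hi.abs) fun ω => hsqrt _
      _ = 1 + ∫ ω, |ξ ω| ∂P := by
          rw [integral_add (integrable_const 1) hi.abs]
          simp
      _ ≤ 1 + R := by linarith [integral_abs_le hR0 (hR' hξ)]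
  have hJ0 : ∀ ξ, 0 ≤ J ξ := fun ξ => integral_nonneg fun ω => Real.sqrt_nonneg _
  let m : ℕ → ℝ := fun k => sInf (J '' S k)
  have hbb : ∀ k, BddBelow (J '' S k) := fun k => ⟨0, by rintro _ ⟨ξ, -, rfl⟩; exact hJ0 ξ⟩
  have hmle : ∀ {k ξ}, ξ ∈ S k → m k ≤ J ξ := fun hξ => csInf_le (hbb _) ⟨_, hξ, rfl⟩
  have hmono : Monotone m := fun k l hkl =>
    csInf_le_csInf (hbb k) ((hne l).image J) (Set.image_mono (hS hkl))
  have hmbdd : BddAbove (Set.range m) := ⟨1 + R, by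
    rintro _ ⟨k, rfl⟩
    obtain ⟨ξ, hξ⟩ := hne k
    exact (hmle hξ).trans (hJle hξ)⟩
  have hmlim := tendsto_atTop_ciSup hmono hmbdd
  set μ := ⨆ k, m k
  have hex : ∀ k : ℕ, ∃ ξ ∈ S k, J ξ < m k + 1 / ((k : ℝ) + 1) := by
    intro k
    obtain ⟨_, ⟨ξ, hξ, rfl⟩, h1⟩ := exists_lt_of_csInf_lt ((hne k).image J)
      (lt_add_of_pos_right (m k) (Nat.one_div_pos_of_nat (n := k) (α := ℝ)))
    exact ⟨ξ, hξ, h1⟩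
  choose u hu huJ using hex
  -- the gap in the midpoint inequality controls the distance in probability
  have hkey : ∀ t : ℝ, 0 < t → ∃ K : ℝ, 0 ≤ K ∧ ∀ k l, k ≤ l →
      ∫ ω, min |u l ω - u k ω| 1 ∂P
        ≤ t * (1 + 2 * R) + K * ((J (u l) + J (u k)) / 2 - m k) := by
    intro t ht
    obtain ⟨K, hK0, hK⟩ := exists_min_abs_sub_le ht
    refine ⟨K, hK0, fun k l hkl => ?_⟩
    have hmid : (1 / 2 : ℝ) • u l + (1 / 2 : ℝ) • u k ∈ S k :=
      hconv k (hS hkl (hu l)) (hu k) (by norm_num) (by norm_num) (by norm_num)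
    have hcoe : ∀ᵐ ω ∂P, ((1 / 2 : ℝ) • u l + (1 / 2 : ℝ) • u k : Ω →ₘ[P] ℝ) ω
        = (u l ω + u k ω) / 2 := by
      filter_upwards [AEEqFun.coeFn_add ((1 / 2 : ℝ) • u l) ((1 / 2 : ℝ) • u k),
        AEEqFun.coeFn_smul (1 / 2 : ℝ) (u l), AEEqFun.coeFn_smul (1 / 2 : ℝ) (u k)]
        with ω h1 h2 h3
      rw [h1, Pi.add_apply, h2, h3, Pi.smul_apply, Pi.smul_apply, smul_eq_mul, smul_eq_mul]
      ring
    have hmidJ : J ((1 / 2 : ℝ) • u l + (1 / 2 : ℝ) • u k)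
        = ∫ ω, √(1 + ((u l ω + u k ω) / 2) ^ 2) ∂P :=
      integral_congr_ae (hcoe.mono fun ω hω => by simp only [hω])
    have hmidI : Integrable (fun ω => √(1 + ((u l ω + u k ω) / 2) ^ 2)) P :=
      (hJint hmid).congr (hcoe.mono fun ω hω => by simp only [hω])
    have hil := integrable_of_lintegral_abs_le (hR' (hu l))
    have hik := integrable_of_lintegral_abs_le (hR' (hu k))
    have hI1 : Integrable (fun ω => 1 + |u l ω| + |u k ω|) P :=
      ((integrable_const 1).add hil.abs).add hik.abs
    have hI2 : Integrable (fun ω => (√(1 + (u l ω) ^ 2) + √(1 + (u k ω) ^ 2)) / 2) P :=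
      ((hJint (hu l)).add (hJint (hu k))).div_const 2
    have hI3 : Integrable (fun ω => (√(1 + (u l ω) ^ 2) + √(1 + (u k ω) ^ 2)) / 2
        - √(1 + ((u l ω + u k ω) / 2) ^ 2)) P := hI2.sub hmidI
    have hI4 : Integrable (fun ω => 1 + |u l ω|) P := (integrable_const 1).add hil.abs
    calc ∫ ω, min |u l ω - u k ω| 1 ∂P
        ≤ ∫ ω, (t * (1 + |u l ω| + |u k ω|) + K * ((√(1 + (u l ω) ^ 2) + √(1 + (u k ω) ^ 2)) / 2
            - √(1 + ((u l ω + u k ω) / 2) ^ 2))) ∂P :=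
          integral_mono (integrable_min_abs_sub_one P _ _)
            ((hI1.const_mul t).add (hI3.const_mul K)) fun ω => hK _ _
      _ = t * (1 + ∫ ω, |u l ω| ∂P + ∫ ω, |u k ω| ∂P) + K * ((J (u l) + J (u k)) / 2
            - J ((1 / 2 : ℝ) • u l + (1 / 2 : ℝ) • u k)) := by
          rw [integral_add (hI1.const_mul t) (hI3.const_mul K), integral_const_mul,
            integral_const_mul, integral_sub hI2 hmidI, integral_div,
            integral_add (hJint (hu l)) (hJint (hu k)),
            integral_add hI4 hik.abs,
            integral_add (integrable_const 1) hil.abs, hmidJ]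
          simp [J]
      _ ≤ _ := by
          have h1 := integral_abs_le hR0 (hR' (hu l))
          have h2 := integral_abs_le hR0 (hR' (hu k))
          have h3 := hmle hmid
          have h4 := mul_le_mul_of_nonneg_left (by linarith :
            1 + ∫ ω, |u l ω| ∂P + ∫ ω, |u k ω| ∂P ≤ 1 + 2 * R) ht.le
          have h5 := mul_le_mul_of_nonneg_left (by linarith :
            (J (u l) + J (u k)) / 2 - J ((1 / 2 : ℝ) • u l + (1 / 2 : ℝ) • u k)
              ≤ (J (u l) + J (u k)) / 2 - m k) hK0
          linarith
  obtain ⟨φ, hφ, f, hlim⟩ := exists_subseq_ae_tendsto u fun ε hε => by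
    have hR1 : 0 < 1 + 2 * R := by linarith
    obtain ⟨K, hK0, hK⟩ := hkey (ε / 2 / (1 + 2 * R)) (by positivity)
    have h1 : Tendsto (fun k : ℕ => K * (μ + 1 / ((k : ℝ) + 1) - m k)) atTop (𝓝 0) := by
      have := ((tendsto_one_div_add_atTop_nhds_zero_nat (𝕜 := ℝ)).const_add μ).sub hmlim
      simpa using this.const_mul K
    obtain ⟨N, hN⟩ := eventually_atTop.1 (h1.eventually_le_const (half_pos hε))
    refine ⟨N, fun k l hk hkl => ?_⟩
    rw [← ofReal_integral_eq_lintegral_ofReal (integrable_min_abs_sub_one P _ _)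
      (Eventually.of_forall fun _ => le_min (abs_nonneg _) zero_le_one)]
    refine ENNReal.ofReal_le_ofReal ((hK k l hkl).trans ?_)
    rw [div_mul_cancel₀ _ hR1.ne']
    have h2 : (J (u l) + J (u k)) / 2 - m k ≤ μ + 1 / ((k : ℝ) + 1) - m k := by
      have h3 : 1 / ((l : ℝ) + 1) ≤ 1 / ((k : ℝ) + 1) := Nat.one_div_le_one_div hkl
      have h4 := huJ l
      have h5 := huJ k
      have h6 : m l ≤ μ := le_ciSup hmbdd l
      have h7 : m k ≤ μ := le_ciSup hmbdd k
      linarith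
    have := mul_le_mul_of_nonneg_left h2 hK0
    linarith [hN k hk]
  exact ⟨fun k => u (φ k), f, fun k => hS (hφ.id_le k) (hu _), hlim⟩

/-! ### Separation of convex sets of integrable random variables -/

/-- A continuous linear functional on `L¹` of a probability space is integration against a bounded
random variable: restrict it to `L²`, represent it there by the Fréchet–Riesz theorem, and test
the representing function on indicators. -/
theorem exists_bounded_density [IsProbabilityMeasure P] (f : Lp ℝ 1 P →L[ℝ] ℝ) :
    ∃ η : Ω →ₘ[P] ℝ, (∀ᵐ ω ∂P, |η ω| ≤ ‖f‖) ∧ ∀ g : Lp ℝ 1 P, f g = ∫ ω, η ω * g ω ∂P := by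
  let ι : Lp ℝ 2 P →L[ℝ] Lp ℝ 1 P := LinearMap.mkContinuous
    { toFun := fun g => ⟨g.1, Lp.antitone (by norm_num) g.2⟩
      map_add' := fun _ _ => rfl
      map_smul' := fun _ _ => rfl } 1 fun g => by
    rw [one_mul, Lp.norm_def, Lp.norm_def]
    exact ENNReal.toReal_mono (Lp.eLpNorm_ne_top g)
      (eLpNorm_le_eLpNorm_of_exponent_le (by norm_num) (Lp.aestronglyMeasurable g))
  let y : Lp ℝ 2 P := (InnerProductSpace.toDual ℝ (Lp ℝ 2 P)).symm (f.comp ι)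
  have hy : ∀ g : Lp ℝ 2 P, f (ι g) = ∫ ω, y ω * g ω ∂P := by
    intro g
    have h1 : inner ℝ y g = f (ι g) := InnerProductSpace.toDual_symm_apply
    rw [← h1, L2.inner_def]
    exact integral_congr_ae (Eventually.of_forall fun ω => by simp [mul_comm])
  have hyint : Integrable y P :=
    memLp_one_iff_integrable.1 ((Lp.memLp y).mono_exponent (by norm_num))
  have hset : ∀ s, MeasurableSet s → |∫ ω in s, y ω ∂P| ≤ ‖f‖ * P.real s := by
    intro s hs
    have h1 : f (ι (indicatorConstLp 2 hs (measure_ne_top P s) 1)) = ∫ ω in s, y ω ∂P := by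
      have h2 : inner ℝ y (indicatorConstLp 2 hs (measure_ne_top P s) (1 : ℝ))
        = f (ι (indicatorConstLp 2 hs (measure_ne_top P s) 1)) :=
        InnerProductSpace.toDual_symm_apply
      rw [← h2, real_inner_comm, L2.inner_indicatorConstLp_one]
    have h3 : ι (indicatorConstLp 2 hs (measure_ne_top P s) 1)
        = indicatorConstLp 1 hs (measure_ne_top P s) 1 := rfl
    rw [← h1, h3]
    refine (f.le_opNorm _).trans (le_of_eq ?_)
    rw [norm_indicatorConstLp one_ne_zero ENNReal.one_ne_top]
    simp
  have hconst : Integrable (fun _ : Ω => ‖f‖) P := integrable_const _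
  have hle : ∀ᵐ ω ∂P, y ω ≤ ‖f‖ := ae_le_of_forall_setIntegral_le hyint hconst fun s hs _ => by
    rw [setIntegral_const, smul_eq_mul, mul_comm]
    exact (le_abs_self _).trans (hset s hs)
  have hge : ∀ᵐ ω ∂P, -y ω ≤ ‖f‖ := ae_le_of_forall_setIntegral_le hyint.neg hconst
    fun s hs _ => by
      rw [setIntegral_const, smul_eq_mul, mul_comm]
      rw [integral_neg]
      exact (neg_le_abs _).trans (hset s hs)
  have habs : ∀ᵐ ω ∂P, |y ω| ≤ ‖f‖ := by
    filter_upwards [hle, hge] with ω h1 h2 using abs_le'.2 ⟨h1, h2⟩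
  have hint : ∀ g : Lp ℝ 1 P, Integrable (fun ω => y ω * g ω) P := fun g =>
    (L1.integrable_coeFn g).bdd_mul (c := ‖f‖) (Lp.aestronglyMeasurable y) habs
  let G : Lp ℝ 1 P →L[ℝ] ℝ := LinearMap.mkContinuous
    { toFun := fun g => ∫ ω, y ω * g ω ∂P
      map_add' := fun g g' => by
        rw [← integral_add (hint g) (hint g')]
        refine integral_congr_ae ?_
        filter_upwards [Lp.coeFn_add g g'] with ω hω
        rw [hω, Pi.add_apply, mul_add]
      map_smul' := fun a g => by
        rw [RingHom.id_apply, smul_eq_mul, ← integral_const_mul]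
        refine integral_congr_ae ?_
        filter_upwards [Lp.coeFn_smul a g] with ω hω
        rw [hω, Pi.smul_apply, smul_eq_mul]
        ring } ‖f‖ fun g => by
    rw [L1.norm_eq_integral_norm, ← integral_const_mul]
    refine norm_integral_le_of_norm_le ((L1.integrable_coeFn g).norm.const_mul _) ?_
    filter_upwards [habs] with ω hω
    rw [norm_mul]
    exact mul_le_mul_of_nonneg_right hω (norm_nonneg _)
  refine ⟨y.1, habs, fun g => ?_⟩
  have hfG : f g = G g := by
    induction g using Lp.induction ENNReal.one_ne_top with
    | indicatorConst c hs hμs =>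
      rw [Lp.simpleFunc.coe_indicatorConst]
      exact hy (indicatorConstLp 2 hs hμs.ne c)
    | add hf hg _ h1 h2 => rw [map_add, map_add, h1, h2]
    | isClosed => exact isClosed_eq f.continuous G.continuous
  exact hfG

/-- Two disjoint a.e. closed convex sets that are bounded in mean are strictly separated by a
bounded random variable. They have positive distance in `L¹`, since otherwise nearly minimal pairs
would converge a.e. to a common element. -/
theorem exists_strict_separation [IsProbabilityMeasure P] {A B : Set (Ω →ₘ[P] ℝ)}
    (hA : Convex ℝ A) (hB : Convex ℝ B) (hAc : AEClosed P A) (hBc : AEClosed P B)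
    (hAB : Disjoint A B) {R : ℝ} (hR0 : 0 ≤ R)
    (hRA : ∀ ξ ∈ A, ∫⁻ ω, ENNReal.ofReal |ξ ω| ∂P ≤ ENNReal.ofReal R)
    (hRB : ∀ ξ ∈ B, ∫⁻ ω, ENNReal.ofReal |ξ ω| ∂P ≤ ENNReal.ofReal R) :
    ∃ η : Ω →ₘ[P] ℝ, (∃ M, ∀ᵐ ω ∂P, |η ω| ≤ M) ∧ ∃ s : ℝ, 0 < s ∧
      ∀ a ∈ A, ∀ b ∈ B, ∫ ω, η ω * b ω ∂P + s ≤ ∫ ω, η ω * a ω ∂P := by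
  let T : Set (Lp ℝ 1 P) := {g | ∃ a ∈ A, ∃ b ∈ B, (g : Ω →ₘ[P] ℝ) = a - b}
  have hcombo : ∀ {a a' b b' g g' : Ω →ₘ[P] ℝ} {s t : ℝ}, g = a - b → g' = a' - b' →
      s • g + t • g' = (s • a + t • a') - (s • b + t • b') := by
    rintro a a' b b' _ _ s t rfl rfl
    rw [smul_sub, smul_sub]
    abel
  have hT : Convex ℝ T := by
    rintro g ⟨a, ha, b, hb, hg⟩ g' ⟨a', ha', b', hb', hg'⟩ s t hs ht hst
    exact ⟨_, hA ha ha' hs ht hst, _, hB hb hb' hs ht hst, hcombo hg hg'⟩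
  have h0 : (0 : Lp ℝ 1 P) ∉ closure T := by
    intro h0
    let S : ℕ → Set (Ω →ₘ[P] ℝ) := fun k =>
      {a | a ∈ A ∧ ∃ b ∈ B, ∃ g : Lp ℝ 1 P, (g : Ω →ₘ[P] ℝ) = a - b ∧ ‖g‖ ≤ (1 / 2) ^ k}
    have hS : Antitone S := by
      rintro k l hkl a ⟨ha, b, hb, g, hg, hgn⟩
      exact ⟨ha, b, hb, g, hg,
        hgn.trans (pow_le_pow_of_le_one (by norm_num) (by norm_num) hkl)⟩
    have hSc : ∀ k, Convex ℝ (S k) := by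
      rintro k a ⟨ha, b, hb, g, hg, hgn⟩ a' ⟨ha', b', hb', g', hg', hgn'⟩ s t hs ht hst
      refine ⟨hA ha ha' hs ht hst, _, hB hb hb' hs ht hst, s • g + t • g', hcombo hg hg', ?_⟩
      have := convex_closedBall (0 : Lp ℝ 1 P) ((1 / 2) ^ k) (mem_closedBall_zero_iff.2 hgn)
        (mem_closedBall_zero_iff.2 hgn') hs ht hst
      exact mem_closedBall_zero_iff.1 this
    have hSn : ∀ k, (S k).Nonempty := by
      intro k
      obtain ⟨g, ⟨a, ha, b, hb, hg⟩, hgn⟩ := Metric.mem_closure_iff.1 h0 ((1 / 2) ^ k)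
        (by positivity)
      rw [dist_zero_left] at hgn
      exact ⟨a, ha, b, hb, g, hg, hgn.le⟩
    obtain ⟨v, f, hv, hlim⟩ := exists_ae_tendsto_of_antitone hS hSc hSn hR0
      fun ξ hξ => hRA ξ hξ.1
    choose hvA b hb g hg hgn using hv
    have hf : f ∈ A := hAc v f hvA hlim
    have h1 := ae_summable_of_tsum_lintegral (P := P) (g := fun k ω => |g k ω|)
      (fun k => (Lp.aestronglyMeasurable (g k)).norm.aemeasurable) (fun k ω => abs_nonneg _)
      (tsum_ne_top_of_le_geometric fun k => by
        refine le_trans (le_of_eq ?_) (ENNReal.ofReal_le_ofReal (hgn k))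
        rw [L1.norm_eq_integral_norm,
          ofReal_integral_norm_eq_lintegral_enorm (L1.integrable_coeFn (g k))]
        exact lintegral_congr fun ω => (Real.enorm_eq_ofReal_abs _).symm)
    have h2 : ∀ᵐ ω ∂P, ∀ k, g k ω = v k ω - b k ω := ae_all_iff.2 fun k => by
      have h3 : (g k : Ω → ℝ) = ((g k : Ω →ₘ[P] ℝ) : Ω → ℝ) := rfl
      rw [h3, hg k]
      filter_upwards [AEEqFun.coeFn_sub (v k) (b k)] with ω hω
      rw [hω, Pi.sub_apply]
    have hf' : f ∈ B := by
      refine hBc b f hb ?_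
      filter_upwards [hlim, h1, h2] with ω h3 h4 h5
      have h6 := h3.sub (tendsto_zero_iff_abs_tendsto_zero _ |>.2 h4.tendsto_atTop_zero)
      simpa [h5] using h6
    exact Set.disjoint_left.1 hAB hf hf'
  obtain ⟨F, s, hs0, hs⟩ := geometric_hahn_banach_point_closed hT.closure isClosed_closure h0
  rw [map_zero] at hs0
  obtain ⟨η, hη, hrep⟩ := exists_bounded_density F
  refine ⟨η, ⟨_, hη⟩, s, hs0, fun a ha b hb => ?_⟩
  have hia := integrable_of_lintegral_abs_le (hRA a ha)
  have hib := integrable_of_lintegral_abs_le (hRB b hb)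
  have hab : a - b ∈ Lp ℝ 1 P := by
    rw [Lp.mem_Lp_iff_memLp, memLp_congr_ae (AEEqFun.coeFn_sub a b)]
    exact memLp_one_iff_integrable.2 (hia.sub hib)
  have h1 := hs ⟨a - b, hab⟩ (subset_closure ⟨a, ha, b, hb, rfl⟩)
  have h2 : F ⟨a - b, hab⟩ = ∫ ω, η ω * a ω ∂P - ∫ ω, η ω * b ω ∂P := by
    rw [hrep, ← integral_sub (hia.bdd_mul η.aestronglyMeasurable hη)
      (hib.bdd_mul η.aestronglyMeasurable hη)]
    refine integral_congr_ae ?_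
    filter_upwards [AEEqFun.coeFn_sub a b] with ω hω
    have h3 : ((⟨a - b, hab⟩ : Lp ℝ 1 P) : Ω → ℝ) ω = (a - b) ω := rfl
    rw [h3, hω, Pi.sub_apply, mul_sub]
  linarith

/-! ### Duality of Orlicz spaces -/

/-- If integration against a bounded `η` is at most `1` on the modular ball of the conjugate, then
the modular of a multiple of `η` is at most `1`; the test element is `Φ(θ) / θ`, where `θ` is this
multiple. -/
theorem modular_le_one_of_polar [IsProbabilityMeasure P] {Φ : ℝ → ℝ} (h : IsYoung Φ)
    {η : Ω →ₘ[P] ℝ} {M : ℝ} (hM : ∀ᵐ ω ∂P, |η ω| ≤ M) {c : ℝ} (hc : 0 < c)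
    (hpol : ∀ ξ : Ω →ₘ[P] ℝ, modular P (youngConj Φ) (fun ω => c * ξ ω) ≤ 1 →
      ∫ ω, η ω * ξ ω ∂P ≤ 1) :
    modular P Φ (fun ω => (2 * c)⁻¹ * η ω) ≤ 1 := by
  let θ : Ω → ℝ := fun ω => (2 * c)⁻¹ * η ω
  have hθ : AEMeasurable θ P := η.aemeasurable.const_mul _
  have hΦθ : AEMeasurable (fun ω => Φ (θ ω)) P := h.measurable.comp_aemeasurable hθ
  have hfin : modular P Φ θ < ∞ := by
    refine lt_of_le_of_lt (modular_mono (g := fun _ => (2 * c)⁻¹ * M) h ?_) ?_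
    · filter_upwards [hM] with ω hω
      simp only [θ]
      rw [abs_mul, abs_mul]
      exact mul_le_mul_of_nonneg_left (hω.trans (le_abs_self M)) (abs_nonneg _)
    · simp [modular]
  by_contra! hlt
  set s := (modular P Φ θ).toReal with hs
  have hs1 : 1 < s := by
    rw [hs]
    exact (ENNReal.toReal_lt_toReal ENNReal.one_ne_top hfin.ne).2 hlt
  have hs0 : 0 < s := by linarith
  have hg : AEMeasurable (fun ω => (c * s)⁻¹ * (Φ (θ ω) / θ ω)) P := (hΦθ.div hθ).const_mul _
  let ξ : Ω →ₘ[P] ℝ := AEEqFun.mk _ hg.aestronglyMeasurable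
  have hξ : ξ =ᵐ[P] fun ω => (c * s)⁻¹ * (Φ (θ ω) / θ ω) := AEEqFun.coeFn_mk _ _
  have h1 : modular P (youngConj Φ) (fun ω => c * ξ ω) ≤ 1 := by
    calc modular P (youngConj Φ) (fun ω => c * ξ ω)
        = modular P (youngConj Φ) (fun ω => s⁻¹ * (Φ (θ ω) / θ ω)) := by
          refine modular_congr (hξ.mono fun ω hω => ?_)
          simp only [hω]
          field_simp
      _ ≤ ENNReal.ofReal s⁻¹ * modular P (youngConj Φ) (fun ω => Φ (θ ω) / θ ω) :=
          modular_mul_le h.conj (by positivity) (inv_le_one_of_one_le₀ hs1.le) _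
      _ ≤ ENNReal.ofReal s⁻¹ * modular P Φ θ := by
          gcongr
          exact lintegral_mono fun ω => ENNReal.ofReal_le_ofReal (h.conj_div_le _)
      _ = 1 := by
          rw [← ENNReal.ofReal_toReal hfin.ne, ← hs, ← ENNReal.ofReal_mul (by positivity),
            inv_mul_cancel₀ hs0.ne', ENNReal.ofReal_one]
  have h2 : ∫ ω, η ω * ξ ω ∂P = 2 := by
    have h3 : ∫ ω, η ω * ξ ω ∂P = ∫ ω, 2 / s * Φ (θ ω) ∂P := by
      refine integral_congr_ae (hξ.mono fun ω hω => ?_)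
      have h4 : η ω = 2 * c * θ ω := by
        simp only [θ]
        field_simp
      simp only [hω]
      rw [h4]
      rcases eq_or_ne (θ ω) 0 with h5 | h5
      · simp [h5, h.zero]
      · field_simp
    rw [h3, integral_const_mul, integral_eq_lintegral_of_nonneg_ae
      (Eventually.of_forall fun ω => h.nonneg _) hΦθ.aestronglyMeasurable]
    change 2 / s * s = 2
    field_simp
  have := hpol ξ h1
  linarith

theorem integrable_mul_of_modular_le {Φ : ℝ → ℝ} (h : IsYoung Φ) {θ ξ : Ω → ℝ}
    (hθm : AEMeasurable θ P) (hξm : AEMeasurable ξ P) (hθ : modular P Φ θ ≤ 1) {c : ℝ}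
    (hc : 0 < c) (hξ : modular P (youngConj Φ) (fun ω => c * ξ ω) ≤ 1) :
    Integrable (fun ω => θ ω * ξ ω) P ∧ ∫ ω, ‖θ ω * ξ ω‖ ∂P ≤ 2 / c := by
  have hm : AEMeasurable (fun ω => θ ω * ξ ω) P := hθm.mul hξm
  have hΦm : AEMeasurable (fun ω => Φ (θ ω)) P := h.measurable.comp_aemeasurable hθm
  have hle : ∫⁻ ω, ENNReal.ofReal ‖θ ω * ξ ω‖ ∂P ≤ ENNReal.ofReal (2 / c) := by
    calc ∫⁻ ω, ENNReal.ofReal ‖θ ω * ξ ω‖ ∂P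
        ≤ ∫⁻ ω, ENNReal.ofReal c⁻¹ * (ENNReal.ofReal (Φ (θ ω))
            + ENNReal.ofReal (youngConj Φ (c * ξ ω))) ∂P := by
          refine lintegral_mono fun ω => ?_
          rw [← ENNReal.ofReal_add (h.nonneg _) (h.conj.nonneg _),
            ← ENNReal.ofReal_mul (by positivity)]
          refine ENNReal.ofReal_le_ofReal ?_
          have h1 := h.mul_le_add |θ ω| |c * ξ ω|
          rw [h.abs, h.conj.abs, abs_mul, abs_of_pos hc] at h1
          rw [inv_mul_eq_div, le_div_iff₀ hc, norm_mul, Real.norm_eq_abs, Real.norm_eq_abs]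
          linarith
      _ = ENNReal.ofReal c⁻¹ * (modular P Φ θ
            + modular P (youngConj Φ) (fun ω => c * ξ ω)) := by
          rw [lintegral_const_mul' _ _ ENNReal.ofReal_ne_top,
            lintegral_add_left' hΦm.ennreal_ofReal]
          rfl
      _ ≤ ENNReal.ofReal c⁻¹ * (1 + 1) := by gcongr
      _ = ENNReal.ofReal (2 / c) := by
          rw [one_add_one_eq_two, ← ENNReal.ofReal_ofNat 2, ← ENNReal.ofReal_mul (by positivity)]
          congr 1
          ring
  have hint : Integrable (fun ω => θ ω * ξ ω) P :=
    ⟨hm.aestronglyMeasurable, (hasFiniteIntegral_iff_norm _).2 (hle.trans_lt ENNReal.ofReal_lt_top)⟩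
  refine ⟨hint, ?_⟩
  rw [integral_eq_lintegral_of_nonneg_ae (Eventually.of_forall fun _ => norm_nonneg _)
    hint.norm.aestronglyMeasurable]
  exact ENNReal.toReal_le_of_le_ofReal (by positivity) hle

/-- Hölder's inequality for Orlicz spaces, in qualitative form. -/
theorem integrable_mul_of_mem {Φ : ℝ → ℝ} (h : IsYoung Φ) {η ξ : Ω →ₘ[P] ℝ}
    (hη : η ∈ orliczSpace P Φ) (hξ : ξ ∈ orliczSpace P (youngConj Φ)) :
    Integrable (fun ω => η ω * ξ ω) P := by
  obtain ⟨a, ha, hη⟩ := exists_modular_le_one h hη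
  obtain ⟨c, hc, hξ⟩ := exists_modular_le_one h.conj hξ
  have := (integrable_mul_of_modular_le h (η.aemeasurable.const_mul a) ξ.aemeasurable hη hc
    hξ).1.const_mul a⁻¹
  refine this.congr (Eventually.of_forall fun ω => ?_)
  field_simp

/-- The modular ball of `L_Φ` is closed under geometric series, and such series are compatible with
the pairing. -/
theorem exists_geometric_series [IsProbabilityMeasure P] {Φ : ℝ → ℝ} (h : IsYoung Φ)
    (θ : ℕ → Ω → ℝ) (hθm : ∀ k, AEMeasurable (θ k) P) (hθ : ∀ k, modular P Φ (θ k) ≤ 1) :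
    ∃ η ∈ orliczSpace P Φ, ∀ ξ ∈ orliczSpace P (youngConj Φ),
      HasSum (fun k => (1 / 2) ^ (k + 1) * ∫ ω, θ k ω * ξ ω ∂P) (∫ ω, η ω * ξ ω ∂P) := by
  obtain ⟨R, hR0, hR⟩ := exists_lintegral_abs_le (P := P) h
  let F : ℕ → Ω → ℝ := fun k ω => (1 / 2) ^ (k + 1) * θ k ω
  have hF : ∀ k, AEMeasurable (F k) P := fun k => (hθm k).const_mul _
  have hgeom : ∀ n, ∑ k ∈ Finset.range n, (1 / 2 : ℝ) ^ (k + 1) ≤ 1 := by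
    intro n
    have := sum_geometric_two_le n
    simp only [pow_succ, ← Finset.sum_mul]
    linarith
  have hsum : ∀ᵐ ω ∂P, Summable fun k => F k ω := by
    have h1 := ae_summable_of_tsum_lintegral (P := P) (g := fun k ω => |F k ω|)
      (fun k => continuous_abs.measurable.comp_aemeasurable (hF k)) (fun k ω => abs_nonneg _) (by
        refine ne_top_of_le_ne_top (ENNReal.mul_ne_top (ENNReal.ofReal_ne_top (r := R))
          (tsum_ne_top_of_le_geometric fun k => le_rfl)) (le_of_le_of_eq (ENNReal.tsum_le_tsum
            fun k => ?_) ENNReal.tsum_mul_left)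
        calc ∫⁻ ω, ENNReal.ofReal |F k ω| ∂P
            ≤ ∫⁻ ω, ENNReal.ofReal ((1 / 2) ^ k) * ENNReal.ofReal |θ k ω| ∂P := by
              refine lintegral_mono fun ω => ?_
              rw [← ENNReal.ofReal_mul (by positivity)]
              refine ENNReal.ofReal_le_ofReal ?_
              simp only [F]
              rw [abs_mul, abs_of_pos (by positivity)]
              gcongr ?_ * _
              exact pow_le_pow_of_le_one (by norm_num) (by norm_num) k.le_succ
          _ = ENNReal.ofReal ((1 / 2) ^ k) * ∫⁻ ω, ENNReal.ofReal |θ k ω| ∂P :=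
              lintegral_const_mul' _ _ ENNReal.ofReal_ne_top
          _ ≤ ENNReal.ofReal R * ENNReal.ofReal ((1 / 2) ^ k) := by
              rw [mul_comm]
              gcongr
              exact hR _ (hθ k))
    filter_upwards [h1] with ω hω using hω.of_abs
  have hpart : ∀ n, AEMeasurable (fun ω => ∑ k ∈ Finset.range n, F k ω) P := fun n =>
    Finset.aemeasurable_fun_sum _ fun k _ => hF k
  have hlim : ∀ᵐ ω ∂P, Tendsto (fun n => ∑ k ∈ Finset.range n, F k ω) atTop
      (𝓝 (∑' k, F k ω)) := by
    filter_upwards [hsum] with ω hω using hω.hasSum.tendsto_sum_nat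
  have hη : AEMeasurable (fun ω => ∑' k, F k ω) P :=
    aemeasurable_of_tendsto_metrizable_ae atTop hpart hlim
  have hmod : modular P Φ (fun ω => ∑' k, F k ω) ≤ 1 := by
    refine modular_le_of_tendsto h hpart (fun n => ?_) hlim
    calc modular P Φ (fun ω => ∑ k ∈ Finset.range n, F k ω)
        ≤ ∫⁻ ω, ∑ k ∈ Finset.range n, ENNReal.ofReal ((1 / 2) ^ (k + 1)) *
            ENNReal.ofReal (Φ (θ k ω)) ∂P := by
          refine lintegral_mono fun ω => ?_
          refine (ENNReal.ofReal_le_ofReal (h.sum_le (Finset.range n)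
            (fun k => (1 / 2) ^ (k + 1)) (fun k => θ k ω) (fun _ _ => by positivity)
            (hgeom n))).trans (le_of_eq ?_)
          rw [ENNReal.ofReal_sum_of_nonneg fun k _ => mul_nonneg (by positivity) (h.nonneg _)]
          exact Finset.sum_congr rfl fun k _ => ENNReal.ofReal_mul (by positivity)
      _ = ∑ k ∈ Finset.range n, ENNReal.ofReal ((1 / 2) ^ (k + 1)) * modular P Φ (θ k) := by
          have hΦm : ∀ k, AEMeasurable (fun ω => Φ (θ k ω)) P := fun k =>
            h.measurable.comp_aemeasurable (hθm k)
          rw [lintegral_finsetSum' _ fun k _ => (hΦm k).ennreal_ofReal.const_mul _]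
          exact Finset.sum_congr rfl fun k _ => lintegral_const_mul' _ _ ENNReal.ofReal_ne_top
      _ ≤ ∑ k ∈ Finset.range n, ENNReal.ofReal ((1 / 2) ^ (k + 1)) * 1 := by
          gcongr with k _
          exact hθ k
      _ ≤ 1 := by
          simp only [mul_one]
          rw [← ENNReal.ofReal_sum_of_nonneg fun _ _ => by positivity]
          exact ENNReal.ofReal_le_one.2 (hgeom n)
  let η : Ω →ₘ[P] ℝ := AEEqFun.mk _ hη.aestronglyMeasurable
  have hηc : η =ᵐ[P] fun ω => ∑' k, F k ω := AEEqFun.coeFn_mk _ _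
  refine ⟨η, ⟨1, one_pos, ?_⟩, fun ξ hξ => ?_⟩
  · simp only [one_mul]
    exact lt_of_le_of_lt ((modular_congr hηc).le.trans hmod) ENNReal.one_lt_top
  · obtain ⟨c, hc, hξ⟩ := exists_modular_le_one h.conj hξ
    have hH := fun k => integrable_mul_of_modular_le h (hθm k) ξ.aemeasurable (hθ k) hc hξ
    have h1 := hasSum_integral_of_summable_integral_norm (μ := P)
      (F := fun k ω => (1 / 2) ^ (k + 1) * (θ k ω * ξ ω)) (fun k => (hH k).1.const_mul _) (by
        refine Summable.of_nonneg_of_le (fun k => integral_nonneg fun ω => norm_nonneg _)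
          (fun k => ?_) (summable_geometric_two.mul_right (2 / c))
        simp only [norm_mul (_ ^ _) _]
        rw [integral_const_mul, norm_pow, Real.norm_of_nonneg (by norm_num)]
        gcongr ?_ * ?_
        · exact pow_le_pow_of_le_one (by norm_num) (by norm_num) k.le_succ
        · exact (hH k).2)
    simp only [integral_const_mul] at h1
    have h2 : ∫ ω, η ω * ξ ω ∂P = ∫ ω, ∑' k, (1 / 2) ^ (k + 1) * (θ k ω * ξ ω) ∂P := by
      refine integral_congr_ae (hηc.mono fun ω hω => ?_)
      simp only [hω, F, ← mul_assoc]
      rw [tsum_mul_right]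
    rwa [h2]

/-! ### The Krein–Šmulian theorem -/

/-- The elements whose dilation by `c` has modular at most `1`. -/
def modularBall (P : Measure Ω) (Ψ : ℝ → ℝ) (c : ℝ) : Set (Ω →ₘ[P] ℝ) :=
  {ξ | modular P Ψ (fun ω => c * ξ ω) ≤ 1}

section ModularBall

variable {Ψ : ℝ → ℝ} {c : ℝ}

theorem convex_modularBall (h : IsYoung Ψ) : Convex ℝ (modularBall P Ψ c) := by
  intro ξ hξ ζ hζ a b ha hb hab
  refine le_trans (le_of_eq (modular_congr ?_)) (modular_combo_le (P := P) h
    (ξ.aemeasurable.const_mul c) hξ hζ ha hb hab)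
  filter_upwards [AEEqFun.coeFn_add (a • ξ) (b • ζ), AEEqFun.coeFn_smul a ξ,
    AEEqFun.coeFn_smul b ζ] with ω h1 h2 h3
  rw [h1, Pi.add_apply, h2, h3, Pi.smul_apply, Pi.smul_apply, smul_eq_mul, smul_eq_mul]
  ring

theorem aeClosed_modularBall (h : IsYoung Ψ) : AEClosed P (modularBall P Ψ c) :=
  fun u _ hu hlim => modular_le_of_tendsto h (fun k => (u k).aemeasurable.const_mul c) hu
    (hlim.mono fun _ hω => hω.const_mul c)

theorem smul_mem_modularBall {ξ : Ω →ₘ[P] ℝ} {a d : ℝ} (hξ : ξ ∈ modularBall P Ψ d)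
    (had : c * a = d) : a • ξ ∈ modularBall P Ψ c := by
  refine le_trans (le_of_eq (modular_congr ?_)) hξ
  filter_upwards [AEEqFun.coeFn_smul a ξ] with ω h1
  rw [h1, Pi.smul_apply, smul_eq_mul, ← mul_assoc, had]

theorem modularBall_anti (h : IsYoung Ψ) {d : ℝ} (hc : 0 ≤ c) (hcd : c ≤ d) :
    modularBall P Ψ d ⊆ modularBall P Ψ c :=
  fun _ hξ => (modular_dilate_mono h hc hcd).trans hξ

theorem exists_lintegral_abs_le_of_modularBall [IsProbabilityMeasure P] (h : IsYoung Ψ) :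
    ∃ R : ℝ, 0 < R ∧ ∀ c : ℝ, 0 < c → ∀ ξ ∈ modularBall P Ψ c,
      ∫⁻ ω, ENNReal.ofReal |ξ ω| ∂P ≤ ENNReal.ofReal (R / c) := by
  obtain ⟨R, hR0, hR⟩ := exists_lintegral_abs_le (P := P) h
  refine ⟨R, hR0, fun c hc ξ hξ => ?_⟩
  have h1 := hR _ hξ
  calc ∫⁻ ω, ENNReal.ofReal |ξ ω| ∂P
      = ∫⁻ ω, ENNReal.ofReal c⁻¹ * ENNReal.ofReal |c * ξ ω| ∂P := by
        refine lintegral_congr fun ω => ?_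
        rw [← ENNReal.ofReal_mul (by positivity), abs_mul, abs_of_pos hc,
          inv_mul_cancel_left₀ hc.ne']
    _ = ENNReal.ofReal c⁻¹ * ∫⁻ ω, ENNReal.ofReal |c * ξ ω| ∂P :=
        lintegral_const_mul' _ _ ENNReal.ofReal_ne_top
    _ ≤ ENNReal.ofReal c⁻¹ * ENNReal.ofReal R := by gcongr
    _ = ENNReal.ofReal (R / c) := by
        rw [← ENNReal.ofReal_mul (by positivity), inv_mul_eq_div]

theorem integrable_mul_of_modularBall [IsProbabilityMeasure P] (h : IsYoung Ψ) (hc : 0 < c)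
    {η ξ : Ω →ₘ[P] ℝ} {M : ℝ} (hη : ∀ᵐ ω ∂P, |η ω| ≤ M) (hξ : ξ ∈ modularBall P Ψ c) :
    Integrable (fun ω => η ω * ξ ω) P := by
  obtain ⟨R, -, hR⟩ := exists_lintegral_abs_le_of_modularBall (P := P) h
  exact (integrable_of_lintegral_abs_le (hR c hc ξ hξ)).bdd_mul η.aestronglyMeasurable hη

/-- On a modular ball, integration against a bounded random variable respects a.e. convergence. -/
theorem tendsto_integral_mul_of_modularBall [IsProbabilityMeasure P] (h : IsYoung Ψ) (hc : 0 < c)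
    {η : Ω →ₘ[P] ℝ} {M : ℝ} (hη : ∀ᵐ ω ∂P, |η ω| ≤ M) {u : ℕ → Ω →ₘ[P] ℝ} {f : Ω →ₘ[P] ℝ}
    (hu : ∀ k, u k ∈ modularBall P Ψ c)
    (hlim : ∀ᵐ ω ∂P, Tendsto (fun k => u k ω) atTop (𝓝 (f ω))) :
    Tendsto (fun k => ∫ ω, η ω * u k ω ∂P) atTop (𝓝 (∫ ω, η ω * f ω ∂P)) := by
  have hf : f ∈ modularBall P Ψ c := aeClosed_modularBall h u f hu hlim
  have hfneg : modular P Ψ (fun ω => -(c * f ω)) ≤ 1 := by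
    have : modular P Ψ (fun ω => c * f ω) ≤ 1 := hf
    simpa only [modular, h.even] using this
  have hd : ∀ k, AEMeasurable (fun ω => c / 2 * (u k ω - f ω)) P := fun k =>
    ((u k).aemeasurable.sub f.aemeasurable).const_mul _
  have h1 := tendsto_lintegral_abs (P := P) h hd (fun k => by
    refine le_trans (le_of_eq (congrArg _ (funext fun ω => ?_)))
      (modular_combo_le h ((u k).aemeasurable.const_mul c) (hu k) hfneg
        (by norm_num : (0 : ℝ) ≤ 1 / 2) (by norm_num : (0 : ℝ) ≤ 1 / 2) (by norm_num))
    ring) (by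
    filter_upwards [hlim] with ω hω
    simpa using (hω.sub_const (f ω)).const_mul (c / 2))
  have h2 := (ENNReal.tendsto_toReal ENNReal.zero_ne_top).comp h1
  have h3 : ∀ k, (∫⁻ ω, ENNReal.ofReal |c / 2 * (u k ω - f ω)| ∂P).toReal
      = c / 2 * ∫ ω, |u k ω - f ω| ∂P := by
    intro k
    have : AEStronglyMeasurable (fun ω => |c / 2 * (u k ω - f ω)|) P :=
      (hd k).aestronglyMeasurable.norm
    rw [← integral_eq_lintegral_of_nonneg_ae (Eventually.of_forall fun _ => abs_nonneg _) this,
      ← integral_const_mul]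
    refine integral_congr_ae (Eventually.of_forall fun ω => ?_)
    simp only [abs_mul, abs_of_pos (half_pos hc)]
  simp only [Function.comp_def, h3, ENNReal.toReal_zero] at h2
  have h4 : Tendsto (fun k => ∫ ω, |u k ω - f ω| ∂P) atTop (𝓝 0) := by
    have := h2.const_mul (c / 2)⁻¹
    simpa only [inv_mul_cancel_left₀ (half_pos hc).ne', mul_zero] using this
  refine tendsto_sub_nhds_zero_iff.1 (squeeze_zero_norm (a := fun k =>
    M * ∫ ω, |u k ω - f ω| ∂P) (fun k => ?_) (by simpa using h4.const_mul M))
  obtain ⟨R, -, hR⟩ := exists_lintegral_abs_le_of_modularBall (P := P) h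
  have hiu := integrable_of_lintegral_abs_le (hR c hc _ (hu k))
  have hif := integrable_of_lintegral_abs_le (hR c hc _ hf)
  rw [← integral_sub (integrable_mul_of_modularBall h hc hη (hu k))
    (integrable_mul_of_modularBall h hc hη hf), ← integral_const_mul]
  refine norm_integral_le_of_norm_le ((hiu.sub hif).abs.const_mul M) ?_
  filter_upwards [hη] with ω hω
  rw [← mul_sub, norm_mul]
  exact mul_le_mul_of_nonneg_right hω (norm_nonneg _)

end ModularBall

theorem integral_smul_right (η ξ : Ω →ₘ[P] ℝ) (a : ℝ) :
    ∫ ω, η ω * (a • ξ) ω ∂P = a * ∫ ω, η ω * ξ ω ∂P := by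
  rw [← integral_const_mul]
  refine integral_congr_ae ?_
  filter_upwards [AEEqFun.coeFn_smul a ξ] with ω hω
  rw [hω, Pi.smul_apply, smul_eq_mul]
  ring

theorem integral_combo {η ξ ζ : Ω →ₘ[P] ℝ} (hξ : Integrable (fun ω => η ω * ξ ω) P)
    (hζ : Integrable (fun ω => η ω * ζ ω) P) (a b : ℝ) :
    ∫ ω, η ω * (a • ξ + b • ζ) ω ∂P
      = a * ∫ ω, η ω * ξ ω ∂P + b * ∫ ω, η ω * ζ ω ∂P := by
  rw [← integral_const_mul, ← integral_const_mul,
    ← integral_add (hξ.const_mul a) (hζ.const_mul b)]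
  refine integral_congr_ae ?_
  filter_upwards [AEEqFun.coeFn_add (a • ξ) (b • ζ), AEEqFun.coeFn_smul a ξ,
    AEEqFun.coeFn_smul b ζ] with ω h1 h2 h3
  rw [h1, Pi.add_apply, h2, h3, Pi.smul_apply, Pi.smul_apply, smul_eq_mul, smul_eq_mul]
  ring

/-- One step of the Krein–Šmulian construction: the part of `D` in the ball of parameter `d` on
which the functionals of `F` are at most `1` is disjoint from the smaller ball of parameter `c`,
hence a bounded random variable separates the two at the level `1`. -/
theorem exists_polar_separation [IsProbabilityMeasure P] {Ψ : ℝ → ℝ} (h : IsYoung Ψ)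
    {D : Set (Ω →ₘ[P] ℝ)} (hD : Convex ℝ D)
    (hcl : ∀ c, 0 < c → AEClosed P (D ∩ modularBall P Ψ c)) {c d : ℝ} (hc : 0 < c) (hd : 0 < d)
    {F : Set (Ω →ₘ[P] ℝ)} (hF : ∀ θ ∈ F, ∃ M, ∀ᵐ ω ∂P, |θ ω| ≤ M)
    (hDF : ∀ ξ ∈ D ∩ modularBall P Ψ c, ∃ θ ∈ F, 1 < ∫ ω, θ ω * ξ ω ∂P) :
    ∃ η : Ω →ₘ[P] ℝ, (∃ M, ∀ᵐ ω ∂P, |η ω| ≤ M) ∧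
      (∀ ξ ∈ modularBall P Ψ c, ∫ ω, η ω * ξ ω ∂P ≤ 1) ∧
      ∀ ξ ∈ D ∩ modularBall P Ψ d, ∃ θ ∈ insert η F, 1 < ∫ ω, θ ω * ξ ω ∂P := by
  let A : Set (Ω →ₘ[P] ℝ) :=
    {ξ | ξ ∈ D ∩ modularBall P Ψ d ∧ ∀ θ ∈ F, ∫ ω, θ ω * ξ ω ∂P ≤ 1}
  rcases A.eq_empty_or_nonempty with hAe | ⟨a₀, ha₀⟩
  · refine ⟨0, ⟨0, ?_⟩, fun ξ _ => ?_, fun ξ hξ => ?_⟩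
    · filter_upwards [AEEqFun.coeFn_zero (μ := P) (β := ℝ)] with ω hω
      simp [hω]
    · have : ∫ ω, (0 : Ω →ₘ[P] ℝ) ω * ξ ω ∂P = ∫ ω, 0 ∂P := by
        refine integral_congr_ae ?_
        filter_upwards [AEEqFun.coeFn_zero (μ := P) (β := ℝ)] with ω hω
        simp [hω]
      rw [this, integral_zero]
      exact zero_le_one
    · by_contra! hcon
      have : ξ ∈ A := ⟨hξ, fun θ hθ => hcon θ (Set.mem_insert_of_mem _ hθ)⟩
      rw [hAe] at this
      exact this
  have hA : Convex ℝ A := by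
    rintro ξ ⟨hξ, hξF⟩ ζ ⟨hζ, hζF⟩ a b ha hb hab
    refine ⟨⟨hD hξ.1 hζ.1 ha hb hab, convex_modularBall h hξ.2 hζ.2 ha hb hab⟩, fun θ hθ => ?_⟩
    obtain ⟨M, hM⟩ := hF θ hθ
    rw [integral_combo (integrable_mul_of_modularBall h hd hM hξ.2)
      (integrable_mul_of_modularBall h hd hM hζ.2)]
    have h1 := mul_le_mul_of_nonneg_left (hξF θ hθ) ha
    have h2 := mul_le_mul_of_nonneg_left (hζF θ hθ) hb
    linarith
  have hAc : AEClosed P A := by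
    intro u f hu hlim
    refine ⟨hcl d hd u f (fun k => (hu k).1) hlim, fun θ hθ => ?_⟩
    obtain ⟨M, hM⟩ := hF θ hθ
    exact le_of_tendsto' (tendsto_integral_mul_of_modularBall h hd hM (fun k => (hu k).1.2) hlim)
      fun k => (hu k).2 θ hθ
  have hdisj : Disjoint A (modularBall P Ψ c) := Set.disjoint_left.2 fun ξ hξ hξc => by
    obtain ⟨θ, hθ, h1⟩ := hDF ξ ⟨hξ.1.1, hξc⟩
    exact absurd (hξ.2 θ hθ) (not_le.2 h1)
  obtain ⟨R, hR0, hR⟩ := exists_lintegral_abs_le_of_modularBall (P := P) h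
  obtain ⟨η, ⟨M, hM⟩, s, hs0, hs⟩ := exists_strict_separation hA (convex_modularBall h) hAc
    (aeClosed_modularBall h) hdisj (R := max (R / c) (R / d))
    (le_max_of_le_left (by positivity))
    (fun ξ hξ => (hR d hd ξ hξ.1.2).trans (ENNReal.ofReal_le_ofReal (le_max_right _ _)))
    (fun ξ hξ => (hR c hc ξ hξ).trans (ENNReal.ofReal_le_ofReal (le_max_left _ _)))
  -- normalise by the supremum of `η` over the small ball, enlarged by half of the gap
  let I : Set ℝ := (fun ξ : Ω →ₘ[P] ℝ => ∫ ω, η ω * ξ ω ∂P) '' modularBall P Ψ c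
  have hbdd : BddAbove I := ⟨∫ ω, η ω * a₀ ω ∂P - s, by
    rintro _ ⟨ξ, hξ, rfl⟩
    linarith [hs a₀ ha₀ ξ hξ]⟩
  have hz0 : ∀ᵐ ω ∂P, (0 : Ω →ₘ[P] ℝ) ω = 0 := AEEqFun.coeFn_zero
  have hz : (0 : Ω →ₘ[P] ℝ) ∈ modularBall P Ψ c := by
    have : modular P Ψ (fun ω => c * (0 : Ω →ₘ[P] ℝ) ω) = ∫⁻ _, 0 ∂P :=
      lintegral_congr_ae (hz0.mono fun ω hω => by simp [hω, h.zero])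
    rw [modularBall, Set.mem_ofPred_eq, this, lintegral_zero]
    exact zero_le_one
  have hI0 : 0 ≤ sSup I := le_csSup hbdd ⟨0, hz, by
    have : ∫ ω, η ω * (0 : Ω →ₘ[P] ℝ) ω ∂P = ∫ _, 0 ∂P :=
      integral_congr_ae (hz0.mono fun ω hω => by simp only [hω, mul_zero])
    exact this.trans (integral_zero _ _)⟩
  set p := sSup I + s / 2 with hp
  have hp0 : 0 < p := by positivity
  have hpb : ∀ ξ ∈ modularBall P Ψ c, ∫ ω, η ω * ξ ω ∂P ≤ p := fun ξ hξ => by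
    have := le_csSup hbdd ⟨ξ, hξ, rfl⟩
    simp only at this
    linarith
  have hpA : ∀ ξ ∈ A, p < ∫ ω, η ω * ξ ω ∂P := fun ξ hξ => by
    have : sSup I ≤ ∫ ω, η ω * ξ ω ∂P - s := csSup_le ⟨_, ⟨0, hz, rfl⟩⟩ (by
      rintro _ ⟨ζ, hζ, rfl⟩
      linarith [hs ξ hξ ζ hζ])
    linarith
  have hsm : ∀ ξ : Ω →ₘ[P] ℝ, ∫ ω, (p⁻¹ • η) ω * ξ ω ∂P = (∫ ω, η ω * ξ ω ∂P) / p := by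
    intro ξ
    rw [← integral_div]
    refine integral_congr_ae ?_
    filter_upwards [AEEqFun.coeFn_smul p⁻¹ η] with ω hω
    rw [hω, Pi.smul_apply, smul_eq_mul]
    ring
  refine ⟨p⁻¹ • η, ⟨p⁻¹ * M, ?_⟩, fun ξ hξ => ?_, fun ξ hξ => ?_⟩
  · filter_upwards [hM, AEEqFun.coeFn_smul p⁻¹ η] with ω h1 h2
    rw [h2, Pi.smul_apply, smul_eq_mul, abs_mul, abs_of_pos (inv_pos.2 hp0)]
    gcongr
  · rw [hsm, div_le_one hp0]
    exact hpb ξ hξ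
  · by_cases hξA : ξ ∈ A
    · exact ⟨_, Set.mem_insert _ _, by rw [hsm, one_lt_div hp0]; exact hpA ξ hξA⟩
    · by_contra! hcon
      exact hξA ⟨hξ, fun θ hθ => hcon θ (Set.mem_insert_of_mem _ hθ)⟩

/-- If `0 ∉ D`, then some ball around `0` misses `D`: elements of `D` in balls that shrink
geometrically would converge to `0` a.e. -/
theorem exists_disjoint_modularBall [IsProbabilityMeasure P] {Ψ : ℝ → ℝ} (h : IsYoung Ψ)
    {D : Set (Ω →ₘ[P] ℝ)} (hcl : AEClosed P (D ∩ modularBall P Ψ 1)) (h0 : (0 : Ω →ₘ[P] ℝ) ∉ D) :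
    ∃ c : ℝ, 0 < c ∧ D ∩ modularBall P Ψ c = ∅ := by
  by_contra! hcon
  obtain ⟨R, hR0, hR⟩ := exists_lintegral_abs_le_of_modularBall (P := P) h
  choose u hu using fun k : ℕ => hcon (2 ^ k) (by positivity)
  have h1 := ae_summable_of_tsum_lintegral (P := P) (g := fun k ω => |u k ω|)
    (fun k => (u k).aestronglyMeasurable.norm.aemeasurable) (fun k ω => abs_nonneg _) (by
      refine ne_top_of_le_ne_top (ENNReal.mul_ne_top (ENNReal.ofReal_ne_top (r := R))
        (tsum_ne_top_of_le_geometric fun k => le_rfl)) (le_of_le_of_eq (ENNReal.tsum_le_tsum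
          fun k => ?_) ENNReal.tsum_mul_left)
      rw [← ENNReal.ofReal_mul hR0.le, one_div, inv_pow, ← div_eq_mul_inv]
      exact hR _ (by positivity) _ (hu k).2)
  refine h0 (hcl u 0 (fun k => ⟨(hu k).1, modularBall_anti h zero_le_one
    (one_le_pow₀ one_le_two) (hu k).2⟩) ?_).1
  filter_upwards [h1, AEEqFun.coeFn_zero (μ := P) (β := ℝ)] with ω h2 h3
  rw [h3]
  exact tendsto_zero_iff_abs_tendsto_zero _ |>.2 h2.tendsto_atTop_zero

/-- Iterating `exists_polar_separation` along the increasing balls of parameters `c 0, c 1, …` gives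
functionals `η k`, the `k`-th bounded by `1` on the `k`-th ball, such that every element of `D` in
one of the balls violates one of the inequalities `⟨η k, ξ⟩ ≤ 1`. -/
theorem exists_polar_sequence [IsProbabilityMeasure P] {Ψ : ℝ → ℝ} (h : IsYoung Ψ)
    {D : Set (Ω →ₘ[P] ℝ)} (hD : Convex ℝ D)
    (hcl : ∀ c, 0 < c → AEClosed P (D ∩ modularBall P Ψ c)) {c : ℕ → ℝ} (hc : ∀ k, 0 < c k)
    (h0 : D ∩ modularBall P Ψ (c 0) = ∅) :
    ∃ η : ℕ → Ω →ₘ[P] ℝ, (∀ k, ∃ M, ∀ᵐ ω ∂P, |η k ω| ≤ M) ∧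
      (∀ k, ∀ ξ ∈ modularBall P Ψ (c k), ∫ ω, η k ω * ξ ω ∂P ≤ 1) ∧
      ∀ n, ∀ ξ ∈ D ∩ modularBall P Ψ (c n), ∃ k, 1 < ∫ ω, η k ω * ξ ω ∂P := by
  have hstep : ∀ n (F : Set (Ω →ₘ[P] ℝ)), ∃ η : Ω →ₘ[P] ℝ,
      (∀ θ ∈ F, ∃ M, ∀ᵐ ω ∂P, |θ ω| ≤ M) →
      (∀ ξ ∈ D ∩ modularBall P Ψ (c n), ∃ θ ∈ F, 1 < ∫ ω, θ ω * ξ ω ∂P) →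
      (∃ M, ∀ᵐ ω ∂P, |η ω| ≤ M) ∧
      (∀ ξ ∈ modularBall P Ψ (c n), ∫ ω, η ω * ξ ω ∂P ≤ 1) ∧
      ∀ ξ ∈ D ∩ modularBall P Ψ (c (n + 1)), ∃ θ ∈ insert η F, 1 < ∫ ω, θ ω * ξ ω ∂P := by
    intro n F
    by_cases hF : (∀ θ ∈ F, ∃ M, ∀ᵐ ω ∂P, |θ ω| ≤ M) ∧
      ∀ ξ ∈ D ∩ modularBall P Ψ (c n), ∃ θ ∈ F, 1 < ∫ ω, θ ω * ξ ω ∂P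
    · obtain ⟨η, hη⟩ := exists_polar_separation h hD hcl (hc n) (hc (n + 1)) hF.1 hF.2
      exact ⟨η, fun _ _ => hη⟩
    · exact ⟨0, fun h1 h2 => absurd ⟨h1, h2⟩ hF⟩
  choose G hG using hstep
  -- `F n` collects the functionals chosen before step `n`
  let F : ℕ → Set (Ω →ₘ[P] ℝ) := fun n => Nat.rec ∅ (fun k S => insert (G k S) S) n
  have hFs : ∀ n, F (n + 1) = insert (G n (F n)) (F n) := fun n => rfl
  have hinv : ∀ n, (∀ θ ∈ F n, ∃ M, ∀ᵐ ω ∂P, |θ ω| ≤ M) ∧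
      ∀ ξ ∈ D ∩ modularBall P Ψ (c n), ∃ θ ∈ F n, 1 < ∫ ω, θ ω * ξ ω ∂P := by
    intro n
    induction n with
    | zero =>
      refine ⟨fun θ hθ => absurd hθ (Set.notMem_empty θ), fun ξ hξ => ?_⟩
      rw [h0] at hξ
      exact absurd hξ (Set.notMem_empty ξ)
    | succ n ih =>
      obtain ⟨h1, -, h3⟩ := hG n (F n) ih.1 ih.2
      rw [hFs]
      exact ⟨fun θ hθ => hθ.elim (fun h => h ▸ h1) (ih.1 θ), h3⟩
  have hmem : ∀ n, ∀ θ ∈ F n, ∃ k, θ = G k (F k) := by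
    intro n
    induction n with
    | zero => exact fun θ hθ => absurd hθ (Set.notMem_empty θ)
    | succ n ih => exact fun θ hθ => hθ.elim (fun h => ⟨n, h⟩) (ih θ)
  refine ⟨fun n => G n (F n), fun k => (hG k _ (hinv k).1 (hinv k).2).1,
    fun k => (hG k _ (hinv k).1 (hinv k).2).2.1, fun n ξ hξ => ?_⟩
  obtain ⟨θ, hθ, h1⟩ := (hinv n).2 ξ hξ
  obtain ⟨k, rfl⟩ := hmem n θ hθ
  exact ⟨k, h1⟩

theorem exists_mem_modularBall {Ψ : ℝ → ℝ} (h : IsYoung Ψ) {ξ : Ω →ₘ[P] ℝ}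
    (hξ : ξ ∈ orliczSpace P Ψ) {c : ℕ → ℝ} (hc : ∀ k, 0 < c k) (hlim : Tendsto c atTop (𝓝 0)) :
    ∃ k, ξ ∈ modularBall P Ψ (c k) := by
  obtain ⟨d, hd, hm⟩ := exists_modular_le_one h hξ
  obtain ⟨k, hk⟩ := (hlim.eventually_le_const hd).exists
  exact ⟨k, modularBall_anti h (hc k).le hk hm⟩

theorem abs_integral_le_div_of_polar {Ψ : ℝ → ℝ} (h : IsYoung Ψ) {η ξ : Ω →ₘ[P] ℝ} {c d : ℝ}
    (hc : 0 < c) (hd : 0 < d) (hη : ∀ ζ ∈ modularBall P Ψ c, ∫ ω, η ω * ζ ω ∂P ≤ 1)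
    (hξ : ξ ∈ modularBall P Ψ d) : |∫ ω, η ω * ξ ω ∂P| ≤ c / d := by
  have hneg : ξ ∈ modularBall P Ψ (-d) := by
    have : modular P Ψ (fun ω => d * ξ ω) ≤ 1 := hξ
    change modular P Ψ (fun ω => -d * ξ ω) ≤ 1
    simpa only [modular, neg_mul, h.even] using this
  have h1 := hη _ (smul_mem_modularBall (a := d / c) hξ (by field_simp))
  have h2 := hη _ (smul_mem_modularBall (a := -d / c) hneg (by field_simp))
  rw [integral_smul_right, div_mul_eq_mul_div, div_le_one hc] at h1 h2
  rw [le_div_iff₀ hd]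
  rcases abs_choice (∫ ω, η ω * ξ ω ∂P) with h3 | h3 <;> rw [h3] <;> linarith

/-- The separation form of the **Krein–Šmulian theorem**. The functionals `η k` furnished by
`exists_polar_sequence` have dual norm of order `4⁻ᵏ`, so `ξ ↦ (2ᵏ ⟨η k, ξ⟩)` maps the Orlicz space
to `ℓ²`, and it maps `D` outside the open unit ball. A vector of `ℓ²` that separates the image of
`D` from the ball gives the coefficients of a series of the `η k` that converges in `L_Φ`. -/
theorem exists_separating_element [IsProbabilityMeasure P] {Φ : ℝ → ℝ} (h : IsYoung Φ)
    {D : Set (Ω →ₘ[P] ℝ)} (hD : Convex ℝ D) (hDm : D ⊆ orliczSpace P (youngConj Φ))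
    (hcl : ∀ c, 0 < c → AEClosed P (D ∩ modularBall P (youngConj Φ) c))
    (h0 : (0 : Ω →ₘ[P] ℝ) ∉ D) :
    ∃ η ∈ orliczSpace P Φ, ∃ s : ℝ, 0 < s ∧ ∀ ξ ∈ D, s ≤ ∫ ω, η ω * ξ ω ∂P := by
  obtain ⟨c, hc, hDc⟩ := exists_disjoint_modularBall h.conj (hcl 1 one_pos) h0
  have hck : ∀ k : ℕ, 0 < c / 4 ^ k := fun k => by positivity
  have hclim : Tendsto (fun k : ℕ => c / 4 ^ k) atTop (𝓝 0) :=
    tendsto_const_nhds.div_atTop (tendsto_pow_atTop_atTop_of_one_lt (by norm_num))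
  obtain ⟨η, hηM, hη1, hηD⟩ := exists_polar_sequence h.conj hD hcl hck
    (by rwa [pow_zero, div_one])
  have hball : ∀ ξ ∈ D, ∃ m : ℕ, ξ ∈ modularBall P (youngConj Φ) (c / 4 ^ m) := fun ξ hξ =>
    exists_mem_modularBall h.conj (hDm hξ) hck hclim
  have hint : ∀ k, ∀ ξ ∈ D, Integrable (fun ω => η k ω * ξ ω) P := fun k ξ hξ => by
    obtain ⟨m, hm⟩ := hball ξ hξ
    obtain ⟨M, hM⟩ := hηM k
    exact integrable_mul_of_modularBall h.conj (hck m) hM hm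
  let V : Set (lp (fun _ : ℕ => ℝ) 2) :=
    {x | ∃ ξ ∈ D, ∀ k, x k = 2 ^ k * ∫ ω, η k ω * ξ ω ∂P}
  have hV : Convex ℝ V := by
    rintro x ⟨ξ, hξ, hx⟩ x' ⟨ξ', hξ', hx'⟩ a b ha hb hab
    refine ⟨_, hD hξ hξ' ha hb hab, fun k => ?_⟩
    rw [integral_combo (hint k ξ hξ) (hint k ξ' hξ'), lp.coeFn_add, Pi.add_apply, lp.coeFn_smul,
      lp.coeFn_smul, Pi.smul_apply, Pi.smul_apply, hx, hx', smul_eq_mul, smul_eq_mul]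
    ring
  have hdisj : Disjoint (Metric.ball (0 : lp (fun _ : ℕ => ℝ) 2) 1) V := by
    refine Set.disjoint_left.2 ?_
    rintro x hxb ⟨ξ, hξ, hx⟩
    obtain ⟨m, hm⟩ := hball ξ hξ
    obtain ⟨k, hk⟩ := hηD m ξ ⟨hξ, hm⟩
    have h1 : ‖x k‖ ≤ ‖x‖ := lp.norm_apply_le_norm two_ne_zero x k
    have h2 : x k ≤ ‖x k‖ := le_abs_self _
    have h3 : ∫ ω, η k ω * ξ ω ∂P ≤ x k := by
      rw [hx]
      exact le_mul_of_one_le_left (by linarith) (one_le_pow₀ one_le_two)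
    rw [mem_ball_zero_iff] at hxb
    linarith
  obtain ⟨f, u, hfu, huf⟩ := geometric_hahn_banach_open (convex_ball _ _) Metric.isOpen_ball hV
    hdisj
  have hu0 : 0 < u := by simpa using hfu 0 (Metric.mem_ball_self one_pos)
  let y : lp (fun _ : ℕ => ℝ) 2 := (InnerProductSpace.toDual ℝ _).symm f
  have hy : ∀ x, HasSum (fun k => y k * x k) (f x) := by
    intro x
    have h1 : inner ℝ y x = f x := InnerProductSpace.toDual_symm_apply
    rw [← h1]
    simpa [mul_comm] using lp.hasSum_inner (𝕜 := ℝ) y x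
  have hY : 0 < ‖y‖ + 1 := by positivity
  let θ : ℕ → Ω → ℝ := fun k ω => y k / (‖y‖ + 1) * ((2 * (c / 4 ^ k))⁻¹ * η k ω)
  have hθm : ∀ k, AEMeasurable (θ k) P := fun k => ((η k).aemeasurable.const_mul _).const_mul _
  have hθ : ∀ k, modular P Φ (θ k) ≤ 1 := by
    intro k
    obtain ⟨M, hM⟩ := hηM k
    refine (modular_mono h (Eventually.of_forall fun ω => ?_)).trans
      (modular_le_one_of_polar h hM (hck k) (hη1 k))
    simp only [θ]
    rw [abs_mul]
    refine mul_le_of_le_one_left (abs_nonneg _) ?_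
    rw [abs_div, abs_of_pos hY, div_le_one hY]
    have : ‖y k‖ ≤ ‖y‖ := lp.norm_apply_le_norm two_ne_zero y k
    rw [Real.norm_eq_abs] at this
    linarith
  obtain ⟨ρ, hρ, hsum⟩ := exists_geometric_series h θ hθm hθ
  refine ⟨ρ, hρ, u / (4 * c * (‖y‖ + 1)), by positivity, fun ξ hξ => ?_⟩
  obtain ⟨m, hm⟩ := hball ξ hξ
  have hmem : Memℓp (fun k : ℕ => (2 : ℝ) ^ k * ∫ ω, η k ω * ξ ω ∂P) 2 := by
    refine Memℓp.of_exponent_ge (q := 1) (memℓp_gen ?_) one_le_two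
    simp only [ENNReal.toReal_one, Real.rpow_one]
    refine Summable.of_nonneg_of_le (fun _ => norm_nonneg _) (fun k => ?_)
      (summable_geometric_two.mul_right ((4 : ℝ) ^ m))
    have h1 := abs_integral_le_div_of_polar h.conj (hck k) (hck m) (hη1 k) hm
    have h2 : c / (4 : ℝ) ^ k / (c / 4 ^ m) = 4 ^ m / (2 ^ k * 2 ^ k) := by
      rw [← mul_pow]
      norm_num
      field_simp
    rw [h2] at h1
    rw [norm_mul, norm_pow, Real.norm_ofNat, Real.norm_eq_abs]
    calc (2 : ℝ) ^ k * |∫ ω, η k ω * ξ ω ∂P| ≤ 2 ^ k * (4 ^ m / (2 ^ k * 2 ^ k)) := by gcongr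
      _ = (1 / 2) ^ k * 4 ^ m := by
        rw [one_div, inv_pow]
        field_simp
  obtain ⟨x, hx⟩ : ∃ x : lp (fun _ : ℕ => ℝ) 2, ∀ k, x k = 2 ^ k * ∫ ω, η k ω * ξ ω ∂P :=
    ⟨⟨_, hmem⟩, fun _ => rfl⟩
  have h1 := huf x ⟨ξ, hξ, hx⟩
  have h2 := (hy x).div_const (4 * c * (‖y‖ + 1))
  have h3 := hsum ξ (hDm hξ)
  have h4 : ∀ k, (1 / 2) ^ (k + 1) * ∫ ω, θ k ω * ξ ω ∂P
      = y k * x k / (4 * c * (‖y‖ + 1)) := by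
    intro k
    have h5 : ∀ ω, θ k ω * ξ ω
        = y k / (‖y‖ + 1) * (2 * (c / 4 ^ k))⁻¹ * (η k ω * ξ ω) := fun ω => by
      simp only [θ]
      ring
    have h6 : (4 : ℝ) ^ k = 2 ^ k * 2 ^ k := by
      rw [← mul_pow]
      norm_num
    simp only [h5]
    rw [integral_const_mul, hx, h6, pow_succ, one_div, inv_pow]
    field_simp
    ring
  simp only [h4] at h3
  rw [h3.unique h2]
  gcongr

/-! ### Weak closedness and order closedness -/

theorem mem_Icc_neg_iff {ξ ζ : Ω →ₘ[P] ℝ} : ξ ∈ Set.Icc (-ζ) ζ ↔ ∀ᵐ ω ∂P, |ξ ω| ≤ ζ ω := by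
  rw [Set.mem_Icc, ← AEEqFun.coeFn_le, ← AEEqFun.coeFn_le]
  constructor
  · rintro ⟨h1, h2⟩
    filter_upwards [h1, h2, AEEqFun.coeFn_neg ζ] with ω h3 h4 h5
    rw [h5, Pi.neg_apply] at h3
    exact abs_le.2 ⟨h3, h4⟩
  · intro h
    constructor
    · filter_upwards [h, AEEqFun.coeFn_neg ζ] with ω h3 h5
      rw [h5, Pi.neg_apply]
      exact (abs_le.1 h3).1
    · filter_upwards [h] with ω h3 using (abs_le.1 h3).2

theorem isOrderClosed_of_isClosed [IsProbabilityMeasure P] {Φ : ℝ → ℝ} (h : IsYoung Φ)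
    {C : Set (Ω →ₘ[P] ℝ)} (hC : C ⊆ orliczSpace P (youngConj Φ))
    (hcl : IsClosed[orliczWeakTopology P (youngConj Φ) Φ]
      {ξ : orliczSpace P (youngConj Φ) | ξ.1 ∈ C}) : IsOrderClosed P (youngConj Φ) C := by
  intro ζ hζ
  refine isClosed_lzero_iff.2 fun u f hu hlim => ?_
  have hub : ∀ᵐ ω ∂P, ∀ k, |u k ω| ≤ ζ ω := ae_all_iff.2 fun k => mem_Icc_neg_iff.1 (hu k).2
  have hfb : ∀ᵐ ω ∂P, |f ω| ≤ ζ ω := by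
    filter_upwards [hub, hlim] with ω h1 h2 using le_of_tendsto' h2.abs h1
  have hf : f ∈ orliczSpace P (youngConj Φ) := mem_orliczSpace_of_abs_le h.conj hζ
    (hfb.mono fun ω hω => hω.trans (le_abs_self _))
  refine ⟨?_, mem_Icc_neg_iff.2 hfb⟩
  let _ := orliczWeakTopology P (youngConj Φ) Φ
  have ht : Tendsto (fun k => (⟨u k, hC (hu k).1⟩ : orliczSpace P (youngConj Φ))) atTop
      (𝓝 ⟨f, hf⟩) := by
    rw [nhds_iInf, tendsto_iInf]
    intro η
    rw [nhds_induced, tendsto_comap_iff]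
    refine tendsto_integral_of_dominated_convergence (fun ω => ‖η.1 ω * ζ ω‖)
      (fun k => η.1.aestronglyMeasurable.mul (u k).aestronglyMeasurable)
      (integrable_mul_of_mem h η.2 hζ).norm (fun k => ?_) ?_
    · filter_upwards [hub] with ω hω
      rw [norm_mul, norm_mul]
      gcongr
      exact (hω k).trans (le_abs_self _)
    · filter_upwards [hlim] with ω hω using hω.const_mul _
  exact hcl.mem_of_tendsto ht (Eventually.of_forall fun k => (hu k).1)

/-- Order closedness controls a.e. limits with bounded modular, through dominated convex
combinations. -/
theorem IsOrderClosed.mem_of_ae_tendsto [IsProbabilityMeasure P] {Φ : ℝ → ℝ} (h : IsYoung Φ)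
    (hΔ : IsDeltaTwo Φ) {C : Set (Ω →ₘ[P] ℝ)} (hconv : Convex ℝ C)
    (hC : IsOrderClosed P (youngConj Φ) C) {u : ℕ → Ω →ₘ[P] ℝ} (hu : ∀ k, u k ∈ C)
    {f : Ω →ₘ[P] ℝ} (hlim : ∀ᵐ ω ∂P, Tendsto (fun k => u k ω) atTop (𝓝 (f ω))) {c : ℝ}
    (hc : 0 < c) (hmod : ∀ k, u k ∈ modularBall P (youngConj Φ) c) : f ∈ C := by
  obtain ⟨v, hv, hvlim, ζ, hζ, hvζ⟩ := exists_dominated_combinations h hΔ hconv u hu f hlim hc hmod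
  exact (isClosed_lzero_iff.1 (hC ζ hζ) v f
    (fun m => ⟨hv m, mem_Icc_neg_iff.2 (hvζ m)⟩) hvlim).1

theorem isClosed_of_isOrderClosed [IsProbabilityMeasure P] {Φ : ℝ → ℝ} (h : IsYoung Φ)
    (hΔ : IsDeltaTwo Φ) {C : Set (Ω →ₘ[P] ℝ)} (hC : C ⊆ orliczSpace P (youngConj Φ))
    (hconv : Convex ℝ C) (hord : IsOrderClosed P (youngConj Φ) C) :
    IsClosed[orliczWeakTopology P (youngConj Φ) Φ]
      {ξ : orliczSpace P (youngConj Φ) | ξ.1 ∈ C} := by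
  let _ := orliczWeakTopology P (youngConj Φ) Φ
  refine isOpen_compl_iff.1 (isOpen_iff_forall_mem_open.2 ?_)
  rintro ⟨ξ₀, hξ₀⟩ hξ₀C
  replace hξ₀C : ξ₀ ∉ C := hξ₀C
  let D : Set (Ω →ₘ[P] ℝ) := {ξ | ξ + ξ₀ ∈ C}
  have hD : Convex ℝ D := by
    intro ξ hξ ζ hζ a b ha hb hab
    have h1 : a • ξ + b • ζ + ξ₀ = a • (ξ + ξ₀) + b • (ζ + ξ₀) := by
      rw [smul_add, smul_add, add_add_add_comm, ← add_smul, hab, one_smul]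
    change a • ξ + b • ζ + ξ₀ ∈ C
    rw [h1]
    exact hconv hξ hζ ha hb hab
  have hDm : D ⊆ orliczSpace P (youngConj Φ) := by
    intro ξ hξ
    have h1 := add_mem_orliczSpace h.conj (hC hξ) (smul_mem_orliczSpace h.conj hξ₀ (-1))
    rwa [neg_one_smul, add_neg_cancel_right] at h1
  have hcl : ∀ c, 0 < c → AEClosed P (D ∩ modularBall P (youngConj Φ) c) := by
    intro c hc u f hu hlim
    refine ⟨?_, aeClosed_modularBall h.conj u f (fun k => (hu k).2) hlim⟩
    obtain ⟨c₀, hc₀, hm₀⟩ := exists_modular_le_one h.conj hξ₀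
    have hm : 0 < min c c₀ := lt_min hc hc₀
    refine hord.mem_of_ae_tendsto h hΔ hconv (u := fun k => u k + ξ₀) (fun k => (hu k).1) ?_
      (c := 1 / 2 * min c c₀) (by positivity) fun k => ?_
    · have h1 : ∀ᵐ ω ∂P, ∀ k, (u k + ξ₀) ω = u k ω + ξ₀ ω :=
        ae_all_iff.2 fun k => AEEqFun.coeFn_add _ _
      filter_upwards [hlim, h1, AEEqFun.coeFn_add f ξ₀] with ω h2 h3 h4
      rw [h4]
      simpa only [h3, Pi.add_apply] using h2.add_const (ξ₀ ω)
    · have h3 := modular_combo_le (P := P) h.conj ((u k).aemeasurable.const_mul (min c c₀))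
        ((modular_dilate_mono h.conj hm.le (min_le_left _ _)).trans (hu k).2)
        ((modular_dilate_mono h.conj hm.le (min_le_right _ _)).trans hm₀)
        (by norm_num : (0 : ℝ) ≤ 1 / 2) (by norm_num : (0 : ℝ) ≤ 1 / 2) (by norm_num)
      refine le_trans (le_of_eq (modular_congr ?_)) h3
      filter_upwards [AEEqFun.coeFn_add (u k) ξ₀] with ω hω
      rw [hω, Pi.add_apply]
      ring
  obtain ⟨η, hη, s, hs0, hs⟩ := exists_separating_element h hD hDm hcl (by
    change 0 + ξ₀ ∉ C
    rwa [zero_add])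
  have hcont : Continuous fun ξ : orliczSpace P (youngConj Φ) => ∫ ω, η ω * ξ.1 ω ∂P :=
    continuous_iInf_dom (i := (⟨η, hη⟩ : orliczSpace P Φ)) continuous_induced_dom
  refine ⟨{ξ | ∫ ω, η ω * ξ.1 ω ∂P < ∫ ω, η ω * ξ₀ ω ∂P + s}, ?_,
    isOpen_lt hcont continuous_const, lt_add_of_pos_right _ hs0⟩
  rintro ⟨ξ, hξ⟩ hlt hξC
  have h1 := hs (ξ - ξ₀) (by
    change ξ - ξ₀ + ξ₀ ∈ C
    rw [sub_add_cancel]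
    exact hξC)
  have h2 : ∫ ω, η ω * (ξ - ξ₀) ω ∂P = ∫ ω, η ω * ξ ω ∂P - ∫ ω, η ω * ξ₀ ω ∂P := by
    rw [← integral_sub (integrable_mul_of_mem h hη hξ) (integrable_mul_of_mem h hη hξ₀)]
    refine integral_congr_ae ?_
    filter_upwards [AEEqFun.coeFn_sub ξ ξ₀] with ω hω
    rw [hω, Pi.sub_apply, mul_sub]
  have h3 : ∫ ω, η ω * ξ ω ∂P < ∫ ω, η ω * ξ₀ ω ∂P + s := hlt
  linarith

end

theorem theorem4p1 {Ω : Type*} [MeasurableSpace Ω] (P : Measure Ω) [IsProbabilityMeasure P]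
    (Φ : ℝ → ℝ) (hΦ : IsYoung Φ) (hΔ : IsDeltaTwo Φ)
    (C : Set (Ω →ₘ[P] ℝ)) (hC : C ⊆ orliczSpace P (youngConj Φ)) (hconv : Convex ℝ C) :
    IsClosed[orliczWeakTopology P (youngConj Φ) Φ]
        {ξ : orliczSpace P (youngConj Φ) | ξ.1 ∈ C} ↔
      IsOrderClosed P (youngConj Φ) C :=
  ⟨isOrderClosed_of_isClosed hΦ hC, isClosed_of_isOrderClosed hΦ hΔ hC hconv⟩
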